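/- Let $d\ge 1$, let $\theta\in\mathbb{R}$ and let $\mathcal{H}=\{z\in\mathbb{C}: \theta-\frac{\pi}{2}<\arg z<\theta+\frac{\pi}{2}\}$ be an open half-plane bounded by a line through the origin. Fix a continuous branch $\log$ of the logarithm on $\mathcal{H}$, and put $z^{-\alpha}=e^{-\alpha\log z}$ for $z\in\mathcal{H}$. Let $a\in\mathcal{H}$ and $\boldsymbol{w}=(w_1,\dots,w_d)\in\mathcal{H}^d$, and write $\boldsymbol{n}\cdot\boldsymbol{w}=\sum_{i=1}^d n_iw_i$. The series $\sum_{\boldsymbol{n}\in\mathbb{N}_0^d}(a+\boldsymbol{n}\cdot\boldsymbol{w})^{-\alpha}$ converges for $\Re(\alpha)>d$, and its sum continues analytically to a function $\zeta_{\rm B}(\alpha,a|\boldsymbol{w})$ on $\mathbb{C}\setminus\{1,\dots,d\}$, the Barnes zeta function. Let $\zeta_{\rm B}'$ denote its derivative with respect to $\alpha$. For a function $g$ and $\boldsymbol{v}=(v_1,\dots,v_d)$ put $$F[g(x)]_{x=\boldsymbol{v}}=\sum_{\emptyset\ne s\subseteq\{1,\dots,d\}}(-1)^{d-|s|}\,g\Bigl(\sum_{i\in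 s}v_i\Bigr).$$ Let the higher order Bernoulli polynomials $B_n(a|\boldsymbol{w})$ be defined by $$z^d e^{az}\prod_{i=1}^d\frac{w_i}{e^{w_iz}-1}=\sum_{n\ge 0}B_n(a|\boldsymbol{w})\frac{z^n}{n!},$$ and let the Bernoullian functions ${}_dS_n(a)$ be defined by ${}_dS_n(0)=0$ and $${}_dS_n'(a)=\frac{n!}{(n+d-1)!\prod_{i=1}^dw_i}B_{n+d-1}(a|\boldsymbol{w}).$$ Let ${}_dS_m^{(d)}(0)$ be the $d$-th derivative of ${}_dS_m$ at $0$, and $H_k=\sum_{i=1}^k 1/i$ (with $H_0=0$). Then the limit below exists and $$\zeta_{\rm B}'(0,a|\boldsymbol{w})=\lim_{M\to\infty}\Biggl[-H_dM^d+\sum_{m=0}^{d}\frac{{}_dS_m^{(d)}(0)}{m!(d-m)!}F\bigl[(a+x)^{d-m}\log(a+x)\bigr]_{x=M\boldsymbol{w}}-\sum_{\boldsymbol{n}\in\{0,1,\dots,M-1\}^d}\log(a+\boldsymbol{n}\cdot\boldsymbol{w})\Biggr]+(-1)^d\sum_{m=0}^{d}\frac{{}_dS_m^{(d)}(0)\,H_{d-m}}{m!(d-m)!}a^{d-m}.$$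 -/

import Mathlib

/-- The open half-plane `{z : θ - π/2 < arg z < θ + π/2}`, that is, the right half-plane
rotated by the angle `θ`. -/
def halfPlane (θ : ℝ) : Set ℂ :=
  {z | 0 < (z * Complex.exp (-((θ : ℂ) * Complex.I))).re}

/-- `L` is a (continuous) branch of the logarithm on the set `U`. -/
def IsLogBranch (L : ℂ → ℂ) (U : Set ℂ) : Prop :=
  ContinuousOn L U ∧ ∀ z ∈ U, Complex.exp (L z) = z

/-- The point `a + n · w`, where `n · w = ∑ i, n i * w i`. -/
noncomputable def latticePoint {d : ℕ} (a : ℂ) (w : Fin d → ℂ) (n : Fin d → ℕ) : ℂ :=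
  a + ∑ i, (n i : ℂ) * w i

/-- `Z` is the Barnes zeta function with parameters `a`, `w` (powers being taken with the branch
`L` of the logarithm, `z ^ (-α) = exp (-α L z)`): for `Re α > d` it is the sum of the convergent
series `∑ₙ (a + n · w) ^ (-α)` over `n ∈ ℕ₀ᵈ`, and it is analytic on `ℂ \ {1, …, d}`.
These two properties determine `Z` on `ℂ \ {1, …, d}`, a connected set. -/
def IsBarnesZeta {d : ℕ} (L : ℂ → ℂ) (a : ℂ) (w : Fin d → ℂ) (Z : ℂ → ℂ) : Prop :=
  (∀ α : ℂ, (d : ℝ) < α.re →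
      HasSum (fun n : Fin d → ℕ => Complex.exp (-α * L (latticePoint a w n))) (Z α)) ∧
    DifferentiableOn ℂ Z {α : ℂ | ∀ q : ℕ, 1 ≤ q → q ≤ d → α ≠ (q : ℂ)}

/-- The Barnes zeta function `α ↦ ζ_B(α, a | w)`: the analytic continuation of the Barnes series
to `ℂ \ {1, …, d}`. -/
noncomputable def barnesZeta {d : ℕ} (L : ℂ → ℂ) (a : ℂ) (w : Fin d → ℂ) : ℂ → ℂ :=
  Classical.epsilon (IsBarnesZeta L a w)

/-- `F[g(x)]_{x = w} = ∑_{∅ ≠ s ⊆ {1, …, d}} (-1)^(d - |s|) g(∑_{i ∈ s} w_i)`. -/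
noncomputable def barnesF {d : ℕ} (w : Fin d → ℂ) (g : ℂ → ℂ) : ℂ :=
  ∑ s : Finset (Fin d) with s.Nonempty, (-1) ^ (d - s.card) * g (∑ i ∈ s, w i)

/-- The formal power series `(e^{cz} - 1) / (cz) = ∑ₙ cⁿ zⁿ / (n+1)!` in `z`. -/
noncomputable def expQuotient (c : ℂ) : PowerSeries ℂ :=
  PowerSeries.mk fun n => c ^ n / ((n + 1).factorial : ℂ)

/-- The Taylor series at `z = 0` of `z^d e^{az} ∏ i, w i / (e^{w i z} - 1)`. -/
noncomputable def bernoulliGenSeries {d : ℕ} (w : Fin d → ℂ) (a : ℂ) : PowerSeries ℂ :=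
  PowerSeries.rescale a (PowerSeries.exp ℂ) * ∏ i, (expQuotient (w i))⁻¹

/-- The higher order Bernoulli polynomial `B_n(a | w)`, as a function of `a`, defined by
`z^d e^{az} ∏ i, w i / (e^{w i z} - 1) = ∑ₙ B_n(a | w) zⁿ / n!`. -/
noncomputable def multBernoulli {d : ℕ} (w : Fin d → ℂ) (n : ℕ) (a : ℂ) : ℂ :=
  (n.factorial : ℂ) * PowerSeries.coeff n (bernoulliGenSeries w a)

/-- The Bernoullian function `_dS_n(a)`, the antiderivative, vanishing at `a = 0`, of
`n! / ((n+d-1)! ∏ i, w i) * B_{n+d-1}(a | w)` (for `d ≥ 1`); it is written here with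
`∫₀ᵃ B_{N-1} = (B_N(a) - B_N(0)) / N`, see `hasDerivAt_bernoullian` and `bernoullian_zero`. -/
noncomputable def bernoullian {d : ℕ} (w : Fin d → ℂ) (n : ℕ) (a : ℂ) : ℂ :=
  (n.factorial : ℂ) / (((n + d - 1).factorial : ℂ) * ∏ i, w i) *
    ((multBernoulli w (n + d) a - multBernoulli w (n + d) 0) / ((n + d : ℕ) : ℂ))

theorem X_mul_expQuotient (c : ℂ) :
    PowerSeries.C c * PowerSeries.X * expQuotient c =
      PowerSeries.rescale c (PowerSeries.exp ℂ) - 1 := by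
  ext n
  rw [mul_assoc, PowerSeries.coeff_C_mul]
  cases n with
  | zero =>
    have h := PowerSeries.coeff_rescale (PowerSeries.exp ℂ) c 0
    rw [PowerSeries.coeff_zero_eq_constantCoeff] at h
    simp [h]
  | succ n =>
    rw [PowerSeries.coeff_succ_X_mul]
    simp [expQuotient, PowerSeries.coeff_rescale, PowerSeries.coeff_exp, PowerSeries.coeff_one]
    ring

/-- The generating function identity, cleared of denominators. -/
theorem bernoulliGenSeries_spec {d : ℕ} (w : Fin d → ℂ) (a : ℂ) :
    (∏ i, (PowerSeries.rescale (w i) (PowerSeries.exp ℂ) - 1)) * bernoulliGenSeries w a =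
      PowerSeries.X ^ d * PowerSeries.rescale a (PowerSeries.exp ℂ) *
        ∏ i, PowerSeries.C (w i) := by
  have h : ∀ i, expQuotient (w i) * (expQuotient (w i))⁻¹ = 1 := fun i =>
    PowerSeries.mul_inv_cancel _ (by simp [expQuotient])
  have h2 : (∏ i, expQuotient (w i)) * ∏ i, (expQuotient (w i))⁻¹ = 1 := by
    rw [← Finset.prod_mul_distrib]; simp [h]
  simp only [← X_mul_expQuotient, Finset.prod_mul_distrib, bernoulliGenSeries,
    Finset.prod_const, Finset.card_univ, Fintype.card_fin]
  linear_combination ((∏ i, PowerSeries.C (w i)) * PowerSeries.X ^ d *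
    PowerSeries.rescale a (PowerSeries.exp ℂ)) * h2

theorem hasDerivAt_multBernoulli {d : ℕ} (w : Fin d → ℂ) (n : ℕ) (a : ℂ) :
    HasDerivAt (multBernoulli w (n + 1)) (((n + 1 : ℕ) : ℂ) * multBernoulli w n a) a := by
  have key : ∀ N : ℕ, multBernoulli w N = fun b : ℂ => (N.factorial : ℂ) *
      ∑ k ∈ Finset.range (N + 1), b ^ k / (k.factorial : ℂ) *
        PowerSeries.coeff (N - k) (∏ i, (expQuotient (w i))⁻¹) := by
    intro N
    funext b
    rw [multBernoulli, bernoulliGenSeries, PowerSeries.coeff_mul,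
      Finset.Nat.sum_antidiagonal_eq_sum_range_succ (fun i j =>
        PowerSeries.coeff i (PowerSeries.rescale b (PowerSeries.exp ℂ)) *
          PowerSeries.coeff j (∏ i, (expQuotient (w i))⁻¹))]
    simp [PowerSeries.coeff_rescale, PowerSeries.coeff_exp, div_eq_mul_inv]
  rw [key (n + 1), key n]
  have hs : HasDerivAt (fun b : ℂ => ∑ k ∈ Finset.range (n + 1 + 1),
      b ^ k / (k.factorial : ℂ) *
        PowerSeries.coeff (n + 1 - k) (∏ i, (expQuotient (w i))⁻¹))
      (∑ k ∈ Finset.range (n + 1 + 1), ((k : ℂ) * a ^ (k - 1)) / (k.factorial : ℂ) *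
        PowerSeries.coeff (n + 1 - k) (∏ i, (expQuotient (w i))⁻¹)) a :=
    HasDerivAt.fun_sum fun k _ => ((hasDerivAt_pow k a).div_const _).mul_const _
  refine (hs.const_mul (((n + 1).factorial : ℕ) : ℂ)).congr_deriv (Eq.symm ?_)
  rw [Finset.sum_range_succ' _ (n + 1), Nat.factorial_succ]
  simp only [Nat.cast_zero, zero_mul, zero_div, add_zero, Nat.cast_mul]
  rw [mul_assoc]
  congr 2
  refine Finset.sum_congr rfl fun k _ => ?_
  have h1 : ((k + 1 : ℕ) : ℂ) ≠ 0 := by exact_mod_cast Nat.succ_ne_zero k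
  have h2 : (k.factorial : ℂ) ≠ 0 := by exact_mod_cast k.factorial_ne_zero
  rw [Nat.factorial_succ, Nat.cast_mul, Nat.add_sub_cancel, Nat.add_sub_add_right]
  field_simp

/-- The defining property of the Bernoullian functions. -/
theorem hasDerivAt_bernoullian {d : ℕ} (hd : 1 ≤ d) (w : Fin d → ℂ) (n : ℕ) (a : ℂ) :
    HasDerivAt (bernoullian w n)
      ((n.factorial : ℂ) / (((n + d - 1).factorial : ℂ) * ∏ i, w i) *
        multBernoulli w (n + d - 1) a) a := by
  obtain ⟨N, hN⟩ : ∃ N, n + d = N + 1 := ⟨n + d - 1, by omega⟩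
  have h1 : ((N + 1 : ℕ) : ℂ) ≠ 0 := by exact_mod_cast Nat.succ_ne_zero N
  unfold bernoullian
  rw [hN, Nat.add_sub_cancel]
  have h := (((hasDerivAt_multBernoulli w N a).sub_const (multBernoulli w (N + 1) 0)).div_const
    ((N + 1 : ℕ) : ℂ)).const_mul ((n.factorial : ℂ) / ((N.factorial : ℂ) * ∏ i, w i))
  rwa [mul_div_cancel_left₀ _ h1] at h

theorem bernoullian_zero {d : ℕ} (w : Fin d → ℂ) (n : ℕ) : bernoullian w n 0 = 0 := by
  simp [bernoullian]

/-- The coefficient `_dS_m^{(d)}(0)`: the `d`-th derivative of `_dS_m` at `0`. -/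
noncomputable def bernoullianCoeff {d : ℕ} (w : Fin d → ℂ) (m : ℕ) : ℂ :=
  iteratedDeriv d (bernoullian w m) 0

/-! Multiplying by u = e^{-iθ} rotates the half-plane onto Re > 0, where L z = log(uz) + κ with κ
constant. For Re α > d, summing geometric series under the integral gives ζ_B(α,a) = e^{-ακ} Γ(α)⁻¹
∫₀^∞ t^{α-1} K_a(t) dt with K_a(t) = e^{-uat} ∏ (1 - e^{-u w_i t})⁻¹ (`hasSum_mellin_barnesKernel`).
Up to a factor t^{-d} and a constant, K_a is e^{-uat} times the Bernoulli generating function at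
-ut. Removing its first N Taylor terms leaves an integral converging for Re α > d - N, and the
removed terms integrate to explicit functions of α. This gives the continuation (`barnesCont`) and,
with N = d + 1, the derivative at 0 as an elementary main part plus a remainder integral
(`hasDerivAt_barnesCont_zero`).

The limit formula comes from inclusion-exclusion over the vertices a + M∑_{i∈S} w_i of a box: the
alternating sum of ζ_B over all S is the finite sum of (a + n·w)^{-α} over the box
(`sum_barnesCont`). Differentiating at 0 turns the right side into minus the sum of logarithms. The
vertex S = ∅ contributes ζ_B'(0,a). At the other vertices the remainder integrals tend to 0 as M → ∞
(`tendsto_mellin_remKernel`). In the main parts, the logarithms assemble into the F-terms, while the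
harmonic numbers multiply d-th differences of polynomials of degree at most d, of which only H_d M^d
survives (`sum_barnesDerivMain`). -/

open Filter Asymptotics Topology MeasureTheory Set

/-! ### Algebra of asymptotic expansions at 0. -/

/-- The function `f` has the asymptotic expansion `A` at `0`. -/
def HasAsymptoticSeries (f : ℂ → ℂ) (A : PowerSeries ℂ) : Prop :=
  ∀ N : ℕ, (fun z => f z - (PowerSeries.trunc N A).eval z) =O[𝓝[≠] 0] (fun z => z ^ N)

theorem isBigO_one_eval (p : Polynomial ℂ) :
    (fun z => p.eval z) =O[𝓝[≠] (0 : ℂ)] (fun _ => (1 : ℂ)) :=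
  ((p.continuous.tendsto 0).mono_left nhdsWithin_le_nhds).isBigO_one ℂ

theorem HasAsymptoticSeries.isBigO_one {f : ℂ → ℂ} {A : PowerSeries ℂ}
    (hf : HasAsymptoticSeries f A) : f =O[𝓝[≠] (0 : ℂ)] (fun _ => (1 : ℂ)) := by
  simpa using hf 0

theorem isBigO_eval_of_coeff_eq_zero {p : Polynomial ℂ} {N : ℕ} (h : ∀ k < N, p.coeff k = 0) :
    (fun z => p.eval z) =O[𝓝[≠] (0 : ℂ)] (fun z => z ^ N) := by
  obtain ⟨q, rfl⟩ := Polynomial.X_pow_dvd_iff.2 h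
  simpa using (isBigO_refl (fun z : ℂ => z ^ N) (𝓝[≠] 0)).mul (isBigO_one_eval q)

theorem HasAsymptoticSeries.mul {f g : ℂ → ℂ} {A B : PowerSeries ℂ}
    (hf : HasAsymptoticSeries f A) (hg : HasAsymptoticSeries g B) :
    HasAsymptoticSeries (fun z => f z * g z) (A * B) := by
  intro N
  have h1 : (fun z => f z * (g z - (PowerSeries.trunc N B).eval z)) =O[𝓝[≠] 0]
      (fun z => z ^ N) := by simpa using hf.isBigO_one.mul (hg N)
  have h2 : (fun z => (f z - (PowerSeries.trunc N A).eval z) * (PowerSeries.trunc N B).eval z)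
      =O[𝓝[≠] 0] (fun z => z ^ N) := by
    simpa using (hf N).mul (isBigO_one_eval (PowerSeries.trunc N B))
  have h3 : (fun z => (PowerSeries.trunc N A * PowerSeries.trunc N B -
      PowerSeries.trunc N (A * B)).eval z) =O[𝓝[≠] 0] (fun z => z ^ N) := by
    refine isBigO_eval_of_coeff_eq_zero fun k hk => ?_
    rw [Polynomial.coeff_sub, PowerSeries.coeff_trunc, if_pos hk,
      PowerSeries.coeff_mul_eq_coeff_trunc_mul_trunc _ _ hk, ← Polynomial.coe_mul,
      Polynomial.coeff_coe, sub_self]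
  refine ((h1.add h2).add h3).congr_left fun z => ?_
  simp only [Polynomial.eval_sub, Polynomial.eval_mul]
  ring

theorem hasAsymptoticSeries_one : HasAsymptoticSeries (fun _ => 1) 1 := by
  intro N
  cases N with
  | zero => simpa using isBigO_refl (fun _ : ℂ => (1 : ℂ)) (𝓝[≠] 0)
  | succ N =>
    rw [PowerSeries.trunc_one]
    simp only [Polynomial.eval_one, sub_self]
    exact isBigO_zero _ _

theorem HasAsymptoticSeries.prod {ι : Type*} (s : Finset ι) {f : ι → ℂ → ℂ}
    {A : ι → PowerSeries ℂ} (h : ∀ i ∈ s, HasAsymptoticSeries (f i) (A i)) :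
    HasAsymptoticSeries (fun z => ∏ i ∈ s, f i z) (∏ i ∈ s, A i) := by
  classical
  induction s using Finset.induction_on with
  | empty => simpa using hasAsymptoticSeries_one
  | insert i s hi ih =>
    simp only [Finset.prod_insert hi]
    exact (h i (Finset.mem_insert_self _ _)).mul
      (ih fun j hj => h j (Finset.mem_insert_of_mem hj))

/-- A polynomial is its own expansion, so `f` times the truncation of `A⁻¹` is 1 + O(z^N) by the
product rule. Dividing by `f`, which stays away from 0 near 0, preserves the error. -/
theorem HasAsymptoticSeries.inv {f : ℂ → ℂ} {A : PowerSeries ℂ}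
    (hf : HasAsymptoticSeries f A) (hA : PowerSeries.constantCoeff A ≠ 0) :
    HasAsymptoticSeries (fun z => (f z)⁻¹) A⁻¹ := by
  have hlim : Tendsto f (𝓝[≠] 0) (𝓝 (PowerSeries.constantCoeff A)) := by
    have h1 := hf 1
    have h2 : Tendsto (fun z : ℂ => z ^ 1) (𝓝[≠] 0) (𝓝 0) := by
      simp only [pow_one]
      exact tendsto_id.mono_left nhdsWithin_le_nhds
    have h3 := (h1.trans_tendsto h2).add_const (PowerSeries.constantCoeff A)
    simpa [PowerSeries.trunc_succ] using h3
  have hne : ∀ᶠ z in 𝓝[≠] 0, f z ≠ 0 := hlim.eventually_ne hA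
  have hinv : (fun z => (f z)⁻¹) =O[𝓝[≠] (0 : ℂ)] (fun _ => (1 : ℂ)) :=
    (hlim.inv₀ hA).isBigO_one ℂ
  intro N
  have hp : HasAsymptoticSeries (fun z => (PowerSeries.trunc N A⁻¹).eval z)
      ((PowerSeries.trunc N A⁻¹ : Polynomial ℂ) : PowerSeries ℂ) := by
    intro M
    have := isBigO_eval_of_coeff_eq_zero (p := PowerSeries.trunc N A⁻¹ -
      PowerSeries.trunc M ((PowerSeries.trunc N A⁻¹ : Polynomial ℂ) : PowerSeries ℂ)) (N := M)
      (fun k hk => by simp [PowerSeries.coeff_trunc, hk])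
    simpa using this
  have hprod := (hf.mul hp) N
  have htr : PowerSeries.trunc N (A * ((PowerSeries.trunc N A⁻¹ : Polynomial ℂ) : PowerSeries ℂ))
      = PowerSeries.trunc N (1 : PowerSeries ℂ) := by
    rw [mul_comm, PowerSeries.trunc_trunc_mul, PowerSeries.inv_mul_cancel _ hA]
  rw [htr] at hprod
  have h1 := (hasAsymptoticSeries_one N).sub hprod
  have h2 := hinv.mul h1
  simp only [one_mul] at h2
  refine h2.congr' ?_ EventuallyEq.rfl
  filter_upwards [hne] with z hz
  field_simp
  ring

/-! ### Taylor coefficients of the generating function and the Bernoullian functions. -/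

theorem hasAsymptoticSeries_expQuotient {c : ℂ} (hc : c ≠ 0) :
    HasAsymptoticSeries (fun z => (Complex.exp (c * z) - 1) / (c * z)) (expQuotient c) := by
  intro N
  -- One order more than `N`, since the division by cz costs a power of z.
  have hexp : (fun z : ℂ => Complex.exp (c * z) -
      ∑ m ∈ Finset.range (N + 1), (c * z) ^ m / (m.factorial : ℂ)) =O[𝓝[≠] 0]
        (fun z => (c * z) ^ (N + 1)) := by
    refine IsBigO.of_bound (Real.exp 1) ?_
    have hs : ∀ᶠ z : ℂ in 𝓝[≠] 0, ‖c * z‖ < 1 := by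
      have : Tendsto (fun z : ℂ => ‖c * z‖) (𝓝[≠] 0) (𝓝 0) := by
        have : Continuous fun z : ℂ => ‖c * z‖ := by fun_prop
        simpa using (this.tendsto 0).mono_left nhdsWithin_le_nhds
      exact this.eventually_lt_const one_pos
    filter_upwards [hs] with z hz
    refine (Complex.norm_exp_sub_sum_le_norm_mul_exp (c * z) (N + 1)).trans ?_
    rw [norm_pow, mul_comm]
    gcongr
  have h2 : (fun z : ℂ => (c * z)⁻¹) =O[𝓝[≠] 0] (fun z => (c * z)⁻¹) := isBigO_refl _ _
  have h3 := hexp.mul h2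
  have hz : ∀ᶠ z : ℂ in 𝓝[≠] 0, z ≠ 0 := self_mem_nhdsWithin
  have h4 : (fun z : ℂ => (c * z) ^ (N + 1) * (c * z)⁻¹) =O[𝓝[≠] 0] (fun z => z ^ N) := by
    refine ((isBigO_refl (fun z : ℂ => z ^ N) (𝓝[≠] 0)).const_mul_left (c ^ N)).congr'
      ?_ EventuallyEq.rfl
    filter_upwards [hz] with z hz
    field_simp
    ring
  refine (h3.trans h4).congr' ?_ EventuallyEq.rfl
  filter_upwards [hz] with z hz
  rw [Polynomial.eval, PowerSeries.eval₂_trunc_eq_sum_range, Finset.sum_range_succ']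
  simp only [expQuotient, PowerSeries.coeff_mk, RingHom.id_apply, pow_zero, Nat.factorial_zero,
    Nat.cast_one, div_one]
  have hcz : c * z ≠ 0 := mul_ne_zero hc hz
  rw [div_eq_mul_inv, ← sub_sub, sub_mul, sub_mul, sub_mul, Finset.sum_mul]
  have : ∑ i ∈ Finset.range N, (c * z) ^ (i + 1) / ((i + 1).factorial : ℂ) * (c * z)⁻¹ =
      ∑ i ∈ Finset.range N, c ^ i / ((i + 1).factorial : ℂ) * z ^ i :=
    Finset.sum_congr rfl fun i _ => by
      rw [pow_succ, mul_pow]; field_simp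
  rw [this]
  ring

/-- The generating function `∏ i, w i z / (e^{w i z} - 1)`. -/
noncomputable def bernoulliGenFun {d : ℕ} (w : Fin d → ℂ) (z : ℂ) : ℂ :=
  ∏ i, (w i * z) / (Complex.exp (w i * z) - 1)

/-- The Taylor coefficients of `bernoulliGenFun`. -/
noncomputable def bernoulliGenCoeff {d : ℕ} (w : Fin d → ℂ) (m : ℕ) : ℂ :=
  PowerSeries.coeff m (∏ i, (expQuotient (w i))⁻¹)

/-- The remainder of the Taylor expansion of `bernoulliGenFun`. -/
noncomputable def bernoulliGenRem {d : ℕ} (w : Fin d → ℂ) (N : ℕ) (z : ℂ) : ℂ :=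
  bernoulliGenFun w z - ∑ m ∈ Finset.range N, bernoulliGenCoeff w m * z ^ m

theorem bernoulliGenRem_isBigO {d : ℕ} {w : Fin d → ℂ} (hw : ∀ i, w i ≠ 0) (N : ℕ) :
    bernoulliGenRem w N =O[𝓝[≠] 0] (fun z => z ^ N) := by
  have h := HasAsymptoticSeries.prod Finset.univ
    (fun i _ => (hasAsymptoticSeries_expQuotient (hw i)).inv (by simp [expQuotient])) N
  refine h.congr_left fun z => ?_
  simp only [inv_div]
  rw [bernoulliGenRem, Polynomial.eval, PowerSeries.eval₂_trunc_eq_sum_range]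
  rfl

theorem bernoulliGenRem_succ {d : ℕ} (w : Fin d → ℂ) (N : ℕ) (z : ℂ) :
    bernoulliGenRem w N z = bernoulliGenCoeff w N * z ^ N + bernoulliGenRem w (N + 1) z := by
  simp only [bernoulliGenRem, Finset.sum_range_succ]
  ring

theorem iteratedDeriv_multBernoulli {d : ℕ} (w : Fin d → ℂ) (m k : ℕ) :
    iteratedDeriv k (multBernoulli w (m + k)) =
      fun a => ((m + k).factorial : ℂ) / (m.factorial : ℂ) * multBernoulli w m a := by
  induction k generalizing m with
  | zero =>
    funext a
    rw [iteratedDeriv_zero, Nat.add_zero, div_self (by exact_mod_cast m.factorial_ne_zero),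
      one_mul]
  | succ k ih =>
    have h := ih (m + 1)
    rw [show m + 1 + k = m + (k + 1) by ring] at h
    rw [iteratedDeriv_succ, h]
    funext a
    rw [((hasDerivAt_multBernoulli w m a).const_mul _).deriv, Nat.factorial_succ m]
    have h1 : ((m + 1 : ℕ) : ℂ) ≠ 0 := by exact_mod_cast Nat.succ_ne_zero m
    have h2 : (m.factorial : ℂ) ≠ 0 := by exact_mod_cast m.factorial_ne_zero
    rw [Nat.cast_mul]
    field_simp

theorem multBernoulli_zero_right {d : ℕ} (w : Fin d → ℂ) (m : ℕ) :
    multBernoulli w m 0 = (m.factorial : ℂ) * bernoulliGenCoeff w m := by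
  rw [multBernoulli, bernoulliGenSeries, bernoulliGenCoeff, PowerSeries.rescale_zero]
  simp

/-- The first derivative is a multiple of B_{m+d-1}; each of the other d - 1 lowers the index by
one, down to B_m(0), and the factorials (m+d-1)! cancel. -/
theorem bernoullianCoeff_eq {d : ℕ} (hd : 1 ≤ d) {w : Fin d → ℂ} (m : ℕ) :
    bernoullianCoeff w m = (m.factorial : ℂ) * bernoulliGenCoeff w m / ∏ i, w i := by
  obtain ⟨k, rfl⟩ : ∃ k, d = k + 1 := ⟨d - 1, by omega⟩
  rw [bernoullianCoeff, iteratedDeriv_succ']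
  have h : deriv (bernoullian w m) = fun a => (m.factorial : ℂ) /
      (((m + (k + 1) - 1).factorial : ℂ) * ∏ i, w i) * multBernoulli w (m + (k + 1) - 1) a :=
    funext fun a => (hasDerivAt_bernoullian hd w m a).deriv
  rw [h, show m + (k + 1) - 1 = m + k by omega, iteratedDeriv_const_mul_field,
    iteratedDeriv_multBernoulli]
  simp only [multBernoulli_zero_right]
  have h1 : ((m + k).factorial : ℂ) ≠ 0 := by exact_mod_cast (m + k).factorial_ne_zero
  have h2 : (m.factorial : ℂ) ≠ 0 := by exact_mod_cast m.factorial_ne_zero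
  field_simp

/-! ### Mellin transform of the exponential with complex rate. -/

theorem norm_cexp_neg_mul_ofReal (r : ℂ) (t : ℝ) :
    ‖Complex.exp (-(r * t))‖ = Real.exp (-r.re * t) := by
  rw [Complex.norm_exp]; simp

theorem mellinConvergent_cexp_neg_mul {s r : ℂ} (hs : 0 < s.re) (hr : 0 < r.re) :
    MellinConvergent (fun t : ℝ => Complex.exp (-(r * t))) s := by
  have hc : Continuous fun t : ℝ => Complex.exp (-(r * t)) := by fun_prop
  refine mellinConvergent_of_isBigO_rpow_exp (a := r.re) (b := 0) hr
    (hc.locallyIntegrable.locallyIntegrableOn _) ?_ ?_ hs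
  · exact IsBigO.of_bound 1 (Eventually.of_forall fun t => by
      rw [norm_cexp_neg_mul_ofReal, one_mul, Real.norm_eq_abs, Real.abs_exp])
  · simpa using ((hc.tendsto 0).mono_left nhdsWithin_le_nhds).isBigO_one ℝ

theorem differentiableAt_mellin_cexp_neg_mul {s r : ℂ} (hs : 0 < s.re) (hr : 0 < r.re) :
    DifferentiableAt ℂ (fun r : ℂ => mellin (fun t : ℝ => Complex.exp (-(r * t))) s) r := by
  have hU : {z : ℂ | r.re / 2 < z.re} ∈ 𝓝 r :=
    (isOpen_lt continuous_const Complex.continuous_re).mem_nhds (by simp; linarith)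
  have hs1 : 0 < (s + 1).re := by simp; linarith
  have hr2 : (0 : ℝ) < ((r.re / 2 : ℝ) : ℂ).re := by simp; linarith
  -- Differentiating in the rate produces a factor t, hence s + 1; the rate Re r / 2 dominates
  -- uniformly near r.
  have hbound := (mellinConvergent_cexp_neg_mul hs1 hr2).norm
  have hmeas : ∀ z : ℂ, 0 < z.re → AEStronglyMeasurable
      (fun t : ℝ => (t : ℂ) ^ (s - 1) • Complex.exp (-(z * t))) (volume.restrict (Ioi 0)) :=
    fun z hz => (mellinConvergent_cexp_neg_mul hs hz).aestronglyMeasurable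
  refine (hasDerivAt_integral_of_dominated_loc_of_deriv_le (μ := volume.restrict (Ioi (0 : ℝ)))
    (F := fun z (t : ℝ) => (t : ℂ) ^ (s - 1) • Complex.exp (-(z * t)))
    (F' := fun z (t : ℝ) => (t : ℂ) ^ (s - 1) * (Complex.exp (-(z * t)) * (-(t : ℂ)))) hU
    ?_ (mellinConvergent_cexp_neg_mul hs hr) ?_ ?_ hbound ?_).2.differentiableAt
  · filter_upwards [hU] with z hz
    exact hmeas z (by have hz' : r.re / 2 < z.re := hz; linarith)
  · have h := (hmeas r hr).mul
      (Continuous.aestronglyMeasurable (f := fun t : ℝ => -(t : ℂ)) (by fun_prop))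
    exact h.congr (ae_of_all _ fun t => mul_assoc _ _ _)
  · filter_upwards [ae_restrict_mem measurableSet_Ioi] with t ht z hz
    have ht0 : (t : ℂ) ≠ 0 := by exact_mod_cast (ne_of_gt ht)
    have ht1 : (0 : ℝ) < t := ht
    have h1 : (t : ℂ) ^ (s + 1 - 1) = (t : ℂ) ^ (s - 1) * t := by
      rw [show s + 1 - 1 = (s - 1) + 1 by ring, Complex.cpow_add _ _ ht0, Complex.cpow_one]
    rw [h1, smul_eq_mul]
    simp only [norm_mul, norm_neg, norm_cexp_neg_mul_ofReal, Complex.ofReal_re]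
    rw [mul_assoc, mul_comm (Real.exp _)]
    have hz' : r.re / 2 < z.re := hz
    gcongr
  · filter_upwards with t z hz
    refine (HasDerivAt.const_mul _ ?_)
    have h : HasDerivAt (fun z : ℂ => -(z * t)) (-(t : ℂ)) z := by
      simpa using ((hasDerivAt_id z).mul_const (t : ℂ)).fun_neg
    exact h.cexp

/-- Both sides are holomorphic in r on Re r > 0, and for real r > 0 this is Euler's integral, so the
identity theorem applies at 1. -/
theorem mellin_cexp_neg_mul {s r : ℂ} (hs : 0 < s.re) (hr : 0 < r.re) :
    mellin (fun t : ℝ => Complex.exp (-(r * t))) s =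
      Complex.Gamma s * Complex.exp (-s * Complex.log r) := by
  have hopen : IsOpen {z : ℂ | 0 < z.re} := isOpen_lt continuous_const Complex.continuous_re
  have hf : AnalyticOnNhd ℂ (fun r : ℂ => mellin (fun t : ℝ => Complex.exp (-(r * t))) s)
      {z : ℂ | 0 < z.re} :=
    DifferentiableOn.analyticOnNhd
      (fun z hz => (differentiableAt_mellin_cexp_neg_mul hs hz).differentiableWithinAt) hopen
  have hg : AnalyticOnNhd ℂ (fun r : ℂ => Complex.Gamma s * Complex.exp (-s * Complex.log r))
      {z : ℂ | 0 < z.re} := by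
    refine DifferentiableOn.analyticOnNhd (fun z hz => ?_) hopen
    exact (((Complex.differentiableAt_log (Or.inl hz)).const_mul _).cexp.const_mul
      _).differentiableWithinAt
  refine hf.eqOn_of_preconnected_of_frequently_eq hg (convex_halfSpace_re_gt 0).isPreconnected
    (z₀ := 1) (by simp) ?_ hr
  have ht : Tendsto (fun x : ℝ => (x : ℂ)) (𝓝[≠] 1) (𝓝[≠] 1) := by
    refine tendsto_nhdsWithin_iff.2 ⟨?_, ?_⟩
    · exact (Complex.continuous_ofReal.tendsto' 1 1 (by simp)).mono_left nhdsWithin_le_nhds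
    · filter_upwards [self_mem_nhdsWithin] with x hx
      simpa using hx
  refine ht.frequently (Eventually.frequently ?_)
  have hpos : ∀ᶠ x : ℝ in 𝓝[≠] 1, 0 < x :=
    nhdsWithin_le_nhds (lt_mem_nhds one_pos)
  filter_upwards [hpos] with x hx
  have hx0 : (x : ℂ) ≠ 0 := by exact_mod_cast hx.ne'
  have := Complex.integral_cpow_mul_exp_neg_mul_Ioi hs hx
  simp only [mellin, smul_eq_mul]
  rw [this, one_div, Complex.inv_cpow _ _ (by
    rw [Complex.arg_ofReal_of_nonneg hx.le]; exact Real.pi_pos.ne), ← Complex.cpow_neg,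
    Complex.cpow_def_of_ne_zero hx0, mul_comm, mul_comm (Complex.log _)]

/-! ### Branches of the logarithm. -/

/-- Two continuous branches of the logarithm on half-planes differ by a constant. -/
theorem IsLogBranch.exists_eq_log_add {L : ℂ → ℂ} {u : ℂ} {U : Set ℂ}
    (hU : IsPreconnected U) (hu : ∀ z ∈ U, 0 < (u * z).re) (hL : IsLogBranch L U)
    (hne : U.Nonempty) :
    ∃ κ : ℂ, Complex.exp (-κ) = u ∧ ∀ z ∈ U, L z = Complex.log (u * z) + κ := by
  have hne0 : ∀ z ∈ U, u * z ≠ 0 := fun z hz h => by simpa [h] using hu z hz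
  have hexp : ∀ z ∈ U, Complex.exp (Complex.log (u * z) - L z) = u := fun z hz => by
    rw [Complex.exp_sub, Complex.exp_log (hne0 z hz), hL.2 z hz,
      mul_div_cancel_right₀ _ (right_ne_zero_of_mul (hne0 z hz))]
  have hcont : ContinuousOn (fun z => Complex.log (u * z) - L z) U :=
    ContinuousOn.sub (fun z hz => ((continuousAt_const.mul continuousAt_id).clog
      (Or.inl (hu z hz))).continuousWithinAt) hL.1
  obtain ⟨z₀, hz₀⟩ := hne
  -- The exponential of the difference of branches is constant, so `g` is integer-valued on U; being
  -- continuous on a connected set, it is constant.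
  set g : ℂ → ℝ := fun z => ((Complex.log (u * z) - L z -
    (Complex.log (u * z₀) - L z₀)) / (2 * Real.pi * Complex.I)).re with hg
  have hgZ : ∀ z ∈ U, ∃ n : ℤ, Complex.log (u * z) - L z =
      Complex.log (u * z₀) - L z₀ + n * (2 * Real.pi * Complex.I) := fun z hz =>
    Complex.exp_eq_exp_iff_exists_int.1 ((hexp z hz).trans (hexp z₀ hz₀).symm)
  have hgn : ∀ z ∈ U, ∀ n : ℤ, Complex.log (u * z) - L z =
      Complex.log (u * z₀) - L z₀ + n * (2 * Real.pi * Complex.I) → g z = n := by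
    intro z hz n hn
    simp only [hg]
    rw [hn, add_sub_cancel_left, mul_div_cancel_right₀ _ Complex.two_pi_I_ne_zero]
    simp
  have hgc : ContinuousOn g U :=
    Complex.continuous_re.comp_continuousOn ((hcont.sub continuousOn_const).div_const _)
  have hconst : ∀ z ∈ U, g z = g z₀ := fun z hz =>
    hU.constant_of_mapsTo (T := range ((↑) : ℤ → ℝ)) (by
      
      rw [isDiscrete_iff_discreteTopology]
      exact Int.isClosedEmbedding_coe_real.isEmbedding.toHomeomorph.symm.isEmbedding.discreteTopology) hgc
      (fun z hz => by
        obtain ⟨n, hn⟩ := hgZ z hz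
        exact ⟨n, (hgn z hz n hn).symm⟩) hz hz₀
  refine ⟨-(Complex.log (u * z₀) - L z₀), by rw [neg_neg]; exact hexp z₀ hz₀, fun z hz => ?_⟩
  obtain ⟨n, hn⟩ := hgZ z hz
  have h1 := hgn z hz n hn
  have h2 : g z₀ = 0 := by simp [hg]
  rw [hconst z hz, h2] at h1
  have h3 : n = 0 := by exact_mod_cast h1.symm
  rw [h3] at hn
  simp only [Int.cast_zero, zero_mul, add_zero] at hn
  linear_combination -hn

/-! ### The remainder kernel and its Mellin transform. -/

/-- The remainder kernel `R_N(-ut) e^{-uat}`. -/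
noncomputable def remKernel {d : ℕ} (u : ℂ) (w : Fin d → ℂ) (N : ℕ) (a : ℂ) (t : ℝ) : ℂ :=
  bernoulliGenRem w N (-(u * t)) * Complex.exp (-(u * a * t))

theorem exp_neg_mul_ne_one {r : ℂ} (hr : 0 < r.re) {t : ℝ} (ht : 0 < t) :
    Complex.exp (-(r * t)) ≠ 1 := by
  intro h
  have h1 := norm_cexp_neg_mul_ofReal r t
  rw [h, norm_one, eq_comm, Real.exp_eq_one_iff] at h1
  nlinarith

theorem continuousOn_remKernel {d : ℕ} {u : ℂ} {w : Fin d → ℂ} (hw : ∀ i, 0 < (u * w i).re)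
    (N : ℕ) (a : ℂ) : ContinuousOn (remKernel u w N a) (Ioi 0) := by
  unfold remKernel bernoulliGenRem bernoulliGenFun
  refine ContinuousOn.mul (ContinuousOn.sub ?_ (by fun_prop)) (by fun_prop)
  refine continuousOn_finsetProd _ fun i _ => ContinuousOn.div (by fun_prop) (by fun_prop) ?_
  intro t ht
  have := exp_neg_mul_ne_one (hw i) ht
  rw [show w i * -(u * (t : ℂ)) = -(u * w i * t) by ring]
  exact sub_ne_zero.2 this

/-- The exponent is written `-(-N)` to match the bound t^{-b}, b = -N, in the Mellin convergence
criterion; this gives the half-plane Re s > -N. -/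
theorem remKernel_isBigO_zero {d : ℕ} {u : ℂ} (hu : u ≠ 0) {w : Fin d → ℂ} (hw : ∀ i, w i ≠ 0)
    (N : ℕ) (a : ℂ) : remKernel u w N a =O[𝓝[>] 0] fun t => t ^ (-(-(N : ℝ))) := by
  have ht : Tendsto (fun t : ℝ => -(u * t)) (𝓝[>] 0) (𝓝[≠] 0) := by
    refine tendsto_nhdsWithin_iff.2 ⟨?_, ?_⟩
    · have : Continuous fun t : ℝ => -(u * t) := by fun_prop
      exact (this.tendsto' 0 0 (by simp)).mono_left nhdsWithin_le_nhds
    · filter_upwards [self_mem_nhdsWithin] with t ht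
      have : t ≠ 0 := ne_of_gt ht
      simp [hu, this]
  have h1 : (fun t : ℝ => bernoulliGenRem w N (-(u * t))) =O[𝓝[>] 0] fun t : ℝ => t ^ N := by
    refine ((bernoulliGenRem_isBigO hw N).comp_tendsto ht).trans ?_
    refine IsBigO.of_bound (‖u‖ ^ N) (Eventually.of_forall fun t => ?_)
    simp [mul_pow]
  have hc : Continuous fun t : ℝ => Complex.exp (-(u * a * t)) := by fun_prop
  have h2 := h1.mul (((hc.tendsto 0).mono_left nhdsWithin_le_nhds).isBigO_one ℝ)
  simp only [mul_one] at h2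
  simpa only [neg_neg, Real.rpow_natCast] using! h2

/-- Each denominator tends to -1, so the Taylor remainder grows at most polynomially; half of the
decay of e^{-uat} absorbs that growth. -/
theorem remKernel_isBigO_atTop {d : ℕ} {u : ℂ} {w : Fin d → ℂ} (hw : ∀ i, 0 < (u * w i).re)
    (N : ℕ) {a : ℂ} (ha : 0 < (u * a).re) :
    remKernel u w N a =O[atTop] fun t => Real.exp (-((u * a).re / 2) * t) := by
  have hpow : ∀ k : ℕ, (fun t : ℝ => t ^ k) =O[atTop]
      fun t : ℝ => Real.exp ((u * a).re / 2 * t) := fun k =>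
    (isLittleO_pow_exp_pos_mul_atTop k (by linarith)).isBigO
  have hfac : ∀ i, (fun t : ℝ => w i * -(u * t) / (Complex.exp (w i * -(u * t)) - 1))
      =O[atTop] fun t : ℝ => t := by
    intro i
    have hlim : Tendsto (fun t : ℝ => Complex.exp (w i * -(u * t))) atTop (𝓝 0) := by
      rw [tendsto_zero_iff_norm_tendsto_zero]
      have : ∀ t : ℝ, ‖Complex.exp (w i * -(u * t))‖ = Real.exp (-((u * w i).re * t)) := by
        intro t
        rw [show w i * -(u * (t : ℂ)) = -(u * w i * t) by ring, norm_cexp_neg_mul_ofReal, neg_mul]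
      simp only [this]
      exact Real.tendsto_exp_neg_atTop_nhds_zero.comp (tendsto_id.const_mul_atTop (hw i))
    have h1 := ((hlim.sub_const 1).inv₀ (by simp)).isBigO_one ℝ
    have h2 : (fun t : ℝ => w i * -(u * t)) =O[atTop] fun t : ℝ => t :=
      IsBigO.of_bound (‖w i‖ * ‖u‖) (Eventually.of_forall fun t => by simp [mul_assoc])
    simpa [div_eq_mul_inv] using h2.mul h1
  have hgen : (fun t : ℝ => bernoulliGenFun w (-(u * t))) =O[atTop]
      fun t : ℝ => Real.exp ((u * a).re / 2 * t) := by
    have := IsBigO.finsetProd (s := Finset.univ) fun i _ => hfac i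
    refine IsBigO.trans ?_ (hpow d)
    simpa [bernoulliGenFun] using this
  have hsum : (fun t : ℝ => ∑ m ∈ Finset.range N, bernoulliGenCoeff w m * (-(u * t)) ^ m)
      =O[atTop] fun t : ℝ => Real.exp ((u * a).re / 2 * t) := by
    refine IsBigO.fun_sum fun m _ => IsBigO.trans ?_ (hpow m)
    refine IsBigO.of_bound (‖bernoulliGenCoeff w m‖ * ‖u‖ ^ m) (Eventually.of_forall fun t => ?_)
    simp [mul_pow, mul_assoc]
  have hexp : (fun t : ℝ => Complex.exp (-(u * a * t))) =O[atTop]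
      fun t : ℝ => Real.exp (-(u * a).re * t) :=
    IsBigO.of_bound 1 (Eventually.of_forall fun t => by
      rw [norm_cexp_neg_mul_ofReal, one_mul, Real.norm_eq_abs, Real.abs_exp])
  refine ((hgen.sub hsum).mul hexp).congr_right fun t => ?_
  rw [← Real.exp_add]
  ring_nf

theorem ne_zero_of_re_mul_pos {u z : ℂ} (h : 0 < (u * z).re) : u ≠ 0 ∧ z ≠ 0 :=
  mul_ne_zero_iff.1 fun h0 => by simp [h0] at h

section

variable {d : ℕ} {u : ℂ} {w : Fin d → ℂ} {a s : ℂ} {N : ℕ}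

theorem mellinConvergent_remKernel (hw : ∀ i, 0 < (u * w i).re) (ha : 0 < (u * a).re)
    (hs : -(N : ℝ) < s.re) : MellinConvergent (remKernel u w N a) s :=
  mellinConvergent_of_isBigO_rpow_exp (half_pos ha)
    ((continuousOn_remKernel hw N a).locallyIntegrableOn measurableSet_Ioi)
    (remKernel_isBigO_atTop hw N ha)
    (remKernel_isBigO_zero (ne_zero_of_re_mul_pos ha).1
      (fun i => (ne_zero_of_re_mul_pos (hw i)).2) N a) hs

theorem differentiableAt_mellin_remKernel (hw : ∀ i, 0 < (u * w i).re) (ha : 0 < (u * a).re)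
    (hs : -(N : ℝ) < s.re) : DifferentiableAt ℂ (mellin (remKernel u w N a)) s :=
  mellin_differentiableAt_of_isBigO_rpow_exp (half_pos ha)
    ((continuousOn_remKernel hw N a).locallyIntegrableOn measurableSet_Ioi)
    (remKernel_isBigO_atTop hw N ha)
    (remKernel_isBigO_zero (ne_zero_of_re_mul_pos ha).1
      (fun i => (ne_zero_of_re_mul_pos (hw i)).2) N a) hs

/-- Peels off one Taylor term, whose factor t^N moves the exponential's Mellin transform from s to s
+ N. This makes different truncations comparable. -/
theorem mellin_remKernel_succ (hw : ∀ i, 0 < (u * w i).re) (ha : 0 < (u * a).re)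
    (hs : -(N : ℝ) < s.re) :
    mellin (remKernel u w N a) s = bernoulliGenCoeff w N * (-u) ^ N *
      (Complex.Gamma (s + N) * Complex.exp (-(s + N) * Complex.log (u * a))) +
        mellin (remKernel u w (N + 1) a) s := by
  have hsN : 0 < (s + N).re := by simp; linarith
  have hconv := mellinConvergent_cexp_neg_mul hsN ha
  have hconv' := (MellinConvergent.cpow_smul (a := (N : ℂ))).2 hconv
  have heq : ∀ t : ℝ, remKernel u w N a t = (bernoulliGenCoeff w N * (-u) ^ N) •
      ((t : ℂ) ^ (N : ℂ) • Complex.exp (-(u * a * t))) + remKernel u w (N + 1) a t := by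
    intro t
    rw [remKernel, remKernel, bernoulliGenRem_succ, Complex.cpow_natCast,
      show -(u * (t : ℂ)) = -u * t by ring, mul_pow]
    simp only [smul_eq_mul]
    ring
  have h2 := mellinConvergent_remKernel (N := N + 1) hw ha (s := s) (by push_cast; linarith)
  have h := (hasMellin_add (hconv'.const_smul (bernoulliGenCoeff w N * (-u) ^ N)) h2).2
  rw [mellin_const_smul, mellin_cpow_smul, mellin_cexp_neg_mul hsN ha] at h
  rw [← smul_eq_mul (bernoulliGenCoeff w N * (-u) ^ N), ← h]
  exact congrArg (fun f => mellin f s) (funext heq)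

end

/-! ### Multiple series over ℕ^d. -/

theorem hasSum_prod_pi {d : ℕ} {R : Type*} [NormedField R] [CompleteSpace R]
    {f : Fin d → ℕ → R} (hf : ∀ i, Summable fun k => ‖f i k‖) :
    Summable (fun n : Fin d → ℕ => ‖∏ i, f i (n i)‖) ∧
      HasSum (fun n : Fin d → ℕ => ∏ i, f i (n i)) (∏ i, ∑' k, f i k) := by
  induction d with
  | zero =>
    refine ⟨Summable.of_finite, ?_⟩
    simp
  | succ d ih =>
    obtain ⟨h1, h2⟩ := ih (f := fun i => f i.succ) fun i => hf i.succ
    let e : ℕ × (Fin d → ℕ) ≃ (Fin (d + 1) → ℕ) := Fin.consEquiv fun _ => ℕ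
    rw [← e.summable_iff, ← e.hasSum_iff]
    have hnorm := Summable.mul_norm (hf 0) h1
    have hcomp : (fun n : Fin (d + 1) → ℕ => ∏ i, f i (n i)) ∘ e =
        fun x : ℕ × (Fin d → ℕ) => f 0 x.1 * ∏ i : Fin d, f i.succ (x.2 i) := by
      funext x
      simp [e, Fin.prod_univ_succ, Fin.consEquiv]
    refine ⟨?_, ?_⟩
    · refine hnorm.congr fun x => ?_
      rw [Function.comp_apply, ← congrFun hcomp x, Function.comp_apply]
    · rw [hcomp, Fin.prod_univ_succ]
      have hA : HasSum (f 0) (∑' k, f 0 k) := (hf 0).of_norm.hasSum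
      have hmul := hA.mul h2
      exact hmul hnorm.of_norm

/-- The linear form is at least c(1 + ∑ n_i). Splitting the power evenly into d factors and bounding
1 + ∑ n_i below by 1 + n_i in the i-th reduces to a product of one-dimensional series with exponent
σ/d > 1. -/
theorem summable_rpow_linear {d : ℕ} (hd : 1 ≤ d) {A : ℝ} (hA : 0 < A) {W : Fin d → ℝ}
    (hW : ∀ i, 0 < W i) {σ : ℝ} (hσ : d < σ) :
    Summable fun n : Fin d → ℕ => (A + ∑ i, n i * W i) ^ (-σ) := by
  have hd0 : (0 : ℝ) < d := by exact_mod_cast hd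
  obtain ⟨c, hc, hcA, hcW⟩ : ∃ c : ℝ, 0 < c ∧ c ≤ A ∧ ∀ i, c ≤ W i := by
    obtain ⟨i, -, hi⟩ := Finset.exists_min_image (Finset.univ : Finset (Fin d)) W
      ⟨⟨0, hd⟩, Finset.mem_univ _⟩
    exact ⟨min A (W i), lt_min hA (hW i), min_le_left _ _,
      fun j => (min_le_right _ _).trans (hi j (Finset.mem_univ _))⟩
  have hsum : Summable fun n : Fin d → ℕ => ∏ i, ((1 : ℝ) + n i) ^ (-(σ / d)) := by
    refine (hasSum_prod_pi (f := fun _ k => ((1 : ℝ) + k) ^ (-(σ / d))) fun _ => ?_).1.of_norm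
    have h1 : Summable fun k : ℕ => (k : ℝ) ^ (-(σ / d)) :=
      Real.summable_nat_rpow.2 (by rw [neg_lt_neg_iff, lt_div_iff₀ hd0]; simpa using hσ)
    refine (((summable_nat_add_iff 1).2 h1)).congr fun k => ?_
    rw [Real.norm_of_nonneg (by positivity)]
    push_cast
    rw [add_comm]
  refine Summable.of_nonneg_of_le (fun n => ?_) (fun n => ?_) (hsum.mul_left (c ^ (-σ)))
  · exact Real.rpow_nonneg (add_nonneg hA.le (Finset.sum_nonneg fun i _ =>
      mul_nonneg (Nat.cast_nonneg _) (hW i).le)) _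
  · have hS : (0 : ℝ) ≤ ∑ i, (n i : ℝ) := Finset.sum_nonneg fun i _ => Nat.cast_nonneg _
    have h1 : c * (1 + ∑ i, (n i : ℝ)) ≤ A + ∑ i, n i * W i := by
      rw [mul_add, mul_one, Finset.mul_sum]
      refine add_le_add hcA (Finset.sum_le_sum fun i _ => ?_)
      rw [mul_comm]
      exact mul_le_mul_of_nonneg_left (hcW i) (Nat.cast_nonneg _)
    have hσ0 : 0 < σ := hd0.trans hσ
    calc (A + ∑ i, n i * W i) ^ (-σ) ≤ (c * (1 + ∑ i, (n i : ℝ))) ^ (-σ) :=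
          Real.rpow_le_rpow_of_nonpos (by positivity) h1 (by linarith)
      _ = c ^ (-σ) * ∏ _i : Fin d, (1 + ∑ i, (n i : ℝ)) ^ (-(σ / d)) := by
          rw [Real.mul_rpow hc.le (by positivity), Finset.prod_const, Finset.card_univ,
            Fintype.card_fin, ← Real.rpow_mul_natCast (by positivity)]
          congr 2
          field_simp
      _ ≤ c ^ (-σ) * ∏ i, ((1 : ℝ) + n i) ^ (-(σ / d)) := by
          refine mul_le_mul_of_nonneg_left (Finset.prod_le_prod (fun i _ => by positivity)
            fun i _ => ?_) (by positivity)
          refine Real.rpow_le_rpow_of_nonpos (by positivity) ?_ ?_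
          · exact add_le_add_right (Finset.single_le_sum (f := fun i => (n i : ℝ))
              (fun j _ => Nat.cast_nonneg _) (Finset.mem_univ i)) _
          · exact neg_nonpos.2 (by positivity)

/-! ### The Barnes kernel: integral representation and inclusion-exclusion. -/

/-- The kernel `e^{-uat} ∏ i, (1 - e^{-u w i t})⁻¹ = ∑ₙ e^{-u(a + n·w)t}`. -/
noncomputable def barnesKernel {d : ℕ} (u : ℂ) (w : Fin d → ℂ) (a : ℂ) (t : ℝ) : ℂ :=
  Complex.exp (-(u * a * t)) * ∏ i, (1 - Complex.exp (-(u * w i * t)))⁻¹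

theorem cexp_latticePoint {d : ℕ} (u : ℂ) (w : Fin d → ℂ) (a : ℂ) (n : Fin d → ℕ) (t : ℝ) :
    Complex.exp (-(u * latticePoint a w n * t)) =
      Complex.exp (-(u * a * t)) * ∏ i, Complex.exp (-(u * w i * t)) ^ n i := by
  simp_rw [← Complex.exp_nat_mul]
  rw [← Complex.exp_sum, ← Complex.exp_add, latticePoint]
  congr 1
  rw [mul_add, add_mul, neg_add, Finset.mul_sum, Finset.sum_mul, ← Finset.sum_neg_distrib]
  congr 1
  exact Finset.sum_congr rfl fun i _ => by ring

section

variable {d : ℕ} {u : ℂ} {w : Fin d → ℂ} {a s : ℂ}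

theorem hasSum_barnesKernel (hw : ∀ i, 0 < (u * w i).re) {t : ℝ} (ht : 0 < t) :
    HasSum (fun n : Fin d → ℕ => Complex.exp (-(u * latticePoint a w n * t)))
      (barnesKernel u w a t) := by
  have hlt : ∀ i, ‖Complex.exp (-(u * w i * t))‖ < 1 := fun i => by
    rw [norm_cexp_neg_mul_ofReal, Real.exp_lt_one_iff]
    nlinarith [hw i]
  have h := (hasSum_prod_pi (f := fun i k => Complex.exp (-(u * w i * t)) ^ k) fun i => by
    simpa only [norm_pow] using summable_geometric_of_lt_one (norm_nonneg _) (hlt i)).2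
  simp_rw [tsum_geometric_of_norm_lt_one (hlt _)] at h
  simpa only [cexp_latticePoint] using! h.mul_left (Complex.exp (-(u * a * t)))

theorem re_mul_latticePoint (n : Fin d → ℕ) :
    (u * latticePoint a w n).re = (u * a).re + ∑ i, n i * (u * w i).re := by
  rw [latticePoint, mul_add, Complex.add_re, Finset.mul_sum, Complex.re_sum]
  congr 1
  refine Finset.sum_congr rfl fun i _ => ?_
  rw [mul_left_comm, ← Complex.ofReal_natCast, Complex.re_ofReal_mul]

theorem re_mul_latticePoint_pos (hw : ∀ i, 0 < (u * w i).re) (ha : 0 < (u * a).re)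
    (n : Fin d → ℕ) : 0 < (u * latticePoint a w n).re := by
  rw [re_mul_latticePoint]
  exact add_pos_of_pos_of_nonneg ha (Finset.sum_nonneg fun i _ =>
    mul_nonneg (Nat.cast_nonneg _) (hw i).le)

/-- Sum and integral may be exchanged because the integrals of the norms are Γ(Re s) (Re u(a +
n·w))^{-Re s}, summable for Re s > d. -/
theorem hasSum_mellin_barnesKernel (hd : 1 ≤ d) (hw : ∀ i, 0 < (u * w i).re)
    (ha : 0 < (u * a).re) (hs : d < s.re) :
    HasSum (fun n : Fin d → ℕ => Complex.Gamma s *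
      Complex.exp (-s * Complex.log (u * latticePoint a w n))) (mellin (barnesKernel u w a) s) := by
  have hs0 : 0 < s.re := lt_of_le_of_lt (Nat.cast_nonneg d) hs
  have hp := re_mul_latticePoint_pos hw ha
  have hint := hasSum_integral_of_summable_integral_norm (μ := volume.restrict (Ioi (0 : ℝ)))
    (F := fun (n : Fin d → ℕ) (t : ℝ) => (t : ℂ) ^ (s - 1) •
      Complex.exp (-(u * latticePoint a w n * t)))
    (fun n => mellinConvergent_cexp_neg_mul hs0 (hp n)) (by
      have hsum := (summable_rpow_linear hd ha hw hs).mul_right (Real.Gamma s.re)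
      refine hsum.congr fun n => ?_
      rw [← re_mul_latticePoint, Real.rpow_neg (hp n).le, ← Real.inv_rpow (hp n).le, ← one_div,
        ← Real.integral_rpow_mul_exp_neg_mul_Ioi hs0 (hp n)]
      refine setIntegral_congr_fun measurableSet_Ioi fun t ht => ?_
      rw [norm_smul, Complex.norm_cpow_eq_rpow_re_of_pos ht, norm_cexp_neg_mul_ofReal,
        neg_mul, Complex.sub_re, Complex.one_re])
  have hL : ∀ n : Fin d → ℕ, ∫ t : ℝ in Ioi 0, (t : ℂ) ^ (s - 1) •
      Complex.exp (-(u * latticePoint a w n * t)) = Complex.Gamma s *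
        Complex.exp (-s * Complex.log (u * latticePoint a w n)) :=
    fun n => mellin_cexp_neg_mul hs0 (hp n)
  simp_rw [hL] at hint
  suffices h : mellin (barnesKernel u w a) s = ∫ t : ℝ in Ioi 0, ∑' n : Fin d → ℕ,
      (t : ℂ) ^ (s - 1) • Complex.exp (-(u * latticePoint a w n * t)) by rwa [h]
  refine setIntegral_congr_fun measurableSet_Ioi fun t ht => ?_
  exact ((hasSum_barnesKernel hw ht).const_smul ((t : ℂ) ^ (s - 1))).tsum_eq.symm

theorem remKernel_zero_eq {t : ℝ} :
    remKernel u w 0 a t = (u ^ d * ∏ i, w i) • ((t : ℂ) ^ (d : ℂ) • barnesKernel u w a t) := by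
  rw [remKernel, barnesKernel, bernoulliGenRem, bernoulliGenFun, Complex.cpow_natCast]
  simp only [Finset.range_zero, Finset.sum_empty, sub_zero, smul_eq_mul]
  have h : ∀ i, w i * -(u * (t : ℂ)) / (Complex.exp (w i * -(u * t)) - 1) =
      (u * w i * t) * (1 - Complex.exp (-(u * w i * t)))⁻¹ := fun i => by
    rw [show w i * -(u * (t : ℂ)) = -(u * w i * t) by ring, div_eq_mul_inv,
      ← neg_sub (1 : ℂ), inv_neg, neg_mul_neg]
  simp_rw [h, Finset.prod_mul_distrib, Finset.prod_const, Finset.card_univ, Fintype.card_fin]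
  ring

theorem mellin_remKernel_zero :
    mellin (remKernel u w 0 a) (s - d) = (u ^ d * ∏ i, w i) * mellin (barnesKernel u w a) s := by
  rw [show remKernel u w 0 a = _ from funext fun t => remKernel_zero_eq, mellin_const_smul,
    mellin_cpow_smul, smul_eq_mul, sub_add_cancel]

theorem mellinConvergent_barnesKernel (hw : ∀ i, 0 < (u * w i).re) (ha : 0 < (u * a).re)
    (hs : d < s.re) : MellinConvergent (barnesKernel u w a) s := by
  have hu := (ne_zero_of_re_mul_pos ha).1
  have hc : u ^ d * ∏ i, w i ≠ 0 := mul_ne_zero (pow_ne_zero _ hu)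
    (Finset.prod_ne_zero_iff.2 fun i _ => (ne_zero_of_re_mul_pos (hw i)).2)
  have h := mellinConvergent_remKernel (N := 0) (s := s - d) hw ha (by simpa using hs)
  rw [show remKernel u w 0 a = _ from funext fun t => remKernel_zero_eq] at h
  have h2 := h.const_smul (u ^ d * ∏ i, w i)⁻¹
  simp_rw [inv_smul_smul₀ hc] at h2
  rw [MellinConvergent.cpow_smul, sub_add_cancel] at h2
  exact h2

theorem hasMellin_sum {ι : Type*} (S : Finset ι) {f : ι → ℝ → ℂ}
    (hf : ∀ i ∈ S, MellinConvergent (f i) s) :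
    HasMellin (fun t => ∑ i ∈ S, f i t) s (∑ i ∈ S, mellin (f i) s) := by
  classical
  induction S using Finset.induction_on with
  | empty => simp [HasMellin, MellinConvergent, mellin]
  | insert i S hi ih =>
    have h1 := hf i (Finset.mem_insert_self _ _)
    have h2 := ih fun j hj => hf j (Finset.mem_insert_of_mem hj)
    have h3 := hasMellin_add h1 h2.1
    simp only [Finset.sum_insert hi]
    rwa [h2.2] at h3

/-- With x_i = e^{-u w_i t}, moving a by M w_i multiplies the exponential by x_i^M. The alternating
sum thus expands ∏ (1 - x_i^M)/(1 - x_i), a product of finite geometric sums. -/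
theorem sum_barnesKernel (hw : ∀ i, 0 < (u * w i).re) (M : ℕ) {t : ℝ} (ht : 0 < t) :
    ∑ S : Finset (Fin d), (-1) ^ S.card * barnesKernel u w (a + ∑ i ∈ S, M * w i) t =
      ∑ n ∈ Fintype.piFinset (fun _ : Fin d => Finset.range M),
        Complex.exp (-(u * latticePoint a w n * t)) := by
  simp only [cexp_latticePoint]
  rw [← Finset.mul_sum, ← Finset.prod_univ_sum (fun _ : Fin d => Finset.range M)
    (fun i k => Complex.exp (-(u * w i * t)) ^ k)]
  have hx : ∀ i, ∑ k ∈ Finset.range M, Complex.exp (-(u * w i * t)) ^ k =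
      (1 + -Complex.exp (-(u * w i * t)) ^ M) * (1 - Complex.exp (-(u * w i * t)))⁻¹ := by
    intro i
    have h1 : 1 - Complex.exp (-(u * w i * t)) ≠ 0 :=
      sub_ne_zero.2 (exp_neg_mul_ne_one (hw i) ht).symm
    rw [eq_mul_inv_iff_mul_eq₀ h1, geom_sum_mul_neg, sub_eq_add_neg]
  simp_rw [hx]
  rw [Finset.prod_mul_distrib, Finset.prod_one_add, Finset.powerset_univ, Finset.sum_mul,
    Finset.mul_sum]
  refine Finset.sum_congr rfl fun S _ => ?_
  have h : Complex.exp (-(u * (a + ∑ i ∈ S, M * w i) * t)) = Complex.exp (-(u * a * t)) *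
      ∏ i ∈ S, Complex.exp (-(u * w i * t)) ^ M := by
    simp_rw [← Complex.exp_nat_mul]
    rw [← Complex.exp_sum, ← Complex.exp_add]
    congr 1
    rw [mul_add, add_mul, neg_add, Finset.mul_sum, Finset.sum_mul, ← Finset.sum_neg_distrib]
    congr 1
    exact Finset.sum_congr rfl fun i _ => by ring
  rw [barnesKernel, h, Finset.prod_neg]
  ring

theorem re_mul_add_sum_pos (hw : ∀ i, 0 < (u * w i).re) (ha : 0 < (u * a).re) (M : ℕ)
    (S : Finset (Fin d)) : 0 < (u * (a + ∑ i ∈ S, M * w i)).re := by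
  rw [mul_add, Complex.add_re, Finset.mul_sum, Complex.re_sum]
  refine add_pos_of_pos_of_nonneg ha (Finset.sum_nonneg fun i _ => ?_)
  rw [mul_left_comm, ← Complex.ofReal_natCast, Complex.re_ofReal_mul]
  exact mul_nonneg (Nat.cast_nonneg _) (hw i).le

theorem sum_mellin_barnesKernel (hw : ∀ i, 0 < (u * w i).re)
    (ha : 0 < (u * a).re) (hs : d < s.re) (M : ℕ) :
    ∑ S : Finset (Fin d), (-1) ^ S.card *
        mellin (barnesKernel u w (a + ∑ i ∈ S, M * w i)) s =
      ∑ n ∈ Fintype.piFinset (fun _ : Fin d => Finset.range M), Complex.Gamma s *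
        Complex.exp (-s * Complex.log (u * latticePoint a w n)) := by
  have hs0 : 0 < s.re := lt_of_le_of_lt (Nat.cast_nonneg d) hs
  have h1 := (hasMellin_sum (s := s) Finset.univ
    (f := fun (S : Finset (Fin d)) t => ((-1) ^ S.card : ℂ) •
      barnesKernel u w (a + ∑ i ∈ S, M * w i) t)
    fun S _ => (mellinConvergent_barnesKernel hw (re_mul_add_sum_pos hw ha M S) hs).const_smul _).2
  have h2 := (hasMellin_sum (s := s) (Fintype.piFinset (fun _ : Fin d => Finset.range M))
    (f := fun n t => Complex.exp (-(u * latticePoint a w n * t)))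
    fun n _ => mellinConvergent_cexp_neg_mul hs0 (re_mul_latticePoint_pos hw ha n)).2
  simp_rw [mellin_const_smul, smul_eq_mul] at h1
  simp_rw [mellin_cexp_neg_mul hs0 (re_mul_latticePoint_pos hw ha _)] at h2
  rw [← h1, ← h2]
  refine setIntegral_congr_fun measurableSet_Ioi fun t ht => ?_
  exact congrArg (fun x => (t : ℂ) ^ (s - 1) • x) (sum_barnesKernel hw M ht)

end

/-! ### Identity theorem away from the poles, and Gamma quotients. -/

/-- The complement of the possible poles `1, …, d`. -/
def poleFree (d : ℕ) : Set ℂ := {α : ℂ | ∀ q : ℕ, 1 ≤ q → q ≤ d → α ≠ (q : ℂ)}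

theorem poleFree_eq (d : ℕ) :
    poleFree d = ((Finset.Icc 1 d).image fun q : ℕ => (q : ℂ) : Set ℂ)ᶜ := by
  ext α
  simp only [poleFree, mem_compl_iff, Finset.coe_image, mem_image, Finset.coe_Icc, mem_Icc]
  exact ⟨fun h ⟨q, hq, hα⟩ => h q hq.1 hq.2 hα.symm, fun h q h1 h2 hα => h ⟨q, ⟨h1, h2⟩, hα.symm⟩⟩

theorem isOpen_poleFree (d : ℕ) : IsOpen (poleFree d) := by
  rw [poleFree_eq]
  exact (Finset.finite_toSet _).isClosed.isOpen_compl

theorem isPreconnected_poleFree (d : ℕ) : IsPreconnected (poleFree d) := by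
  rw [poleFree_eq]
  exact ((Finset.finite_toSet _).countable.isConnected_compl_of_one_lt_rank
    (by rw [Complex.rank_real_complex]; exact Cardinal.one_lt_two)).isPreconnected

theorem zero_mem_poleFree (d : ℕ) : (0 : ℂ) ∈ poleFree d := fun q h1 _ h => by
  have : q = 0 := by exact_mod_cast h.symm
  omega

theorem mem_poleFree_of_lt_re {d : ℕ} {α : ℂ} (h : d < α.re) : α ∈ poleFree d :=
  fun q _ h2 hα => by
    rw [hα, Complex.natCast_re, Nat.cast_lt] at h
    omega

/-- Two functions analytic away from `1, …, d` that agree for `Re α > d` are equal. -/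
theorem eqOn_poleFree {d : ℕ} {f g : ℂ → ℂ} (hf : DifferentiableOn ℂ f (poleFree d))
    (hg : DifferentiableOn ℂ g (poleFree d)) (h : ∀ α : ℂ, d < α.re → f α = g α) :
    EqOn f g (poleFree d) := by
  have hz : (d : ℝ) < ((d + 1 : ℝ) : ℂ).re := by simp
  refine (hf.analyticOnNhd (isOpen_poleFree d)).eqOn_of_preconnected_of_eventuallyEq
    (hg.analyticOnNhd (isOpen_poleFree d)) (isPreconnected_poleFree d)
    (mem_poleFree_of_lt_re hz) ?_
  filter_upwards [(isOpen_lt continuous_const Complex.continuous_re).mem_nhds hz] with α hα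
  exact h α hα

/-- The rational function `Γ(α - d + m) / Γ(α)`. -/
noncomputable def gammaRatio (d m : ℕ) (α : ℂ) : ℂ :=
  (∏ j ∈ Finset.range m, (α - d + j)) / ∏ j ∈ Finset.range d, (α - d + j)

theorem prod_ne_zero_of_mem_poleFree {d : ℕ} {α : ℂ} (h : α ∈ poleFree d) :
    ∏ j ∈ Finset.range d, (α - d + j) ≠ 0 := by
  refine Finset.prod_ne_zero_iff.2 fun j hj h0 => ?_
  have hj' := Finset.mem_range.1 hj
  -- A zero of the j-th factor is the excluded point d - j, which lies in 1, …, d because j < d.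
  refine h (d - j) (by omega) (by omega) ?_
  rw [Nat.cast_sub hj'.le]
  linear_combination h0

theorem Complex.inv_Gamma_eq_prod_mul (s : ℂ) (m : ℕ) :
    (Complex.Gamma s)⁻¹ = (∏ j ∈ Finset.range m, (s + j)) * (Complex.Gamma (s + m))⁻¹ := by
  induction m with
  | zero => simp
  | succ m ih =>
    rw [ih, Complex.one_div_Gamma_eq_self_mul_one_div_Gamma_add_one, Finset.prod_range_succ]
    push_cast
    rw [← add_assoc]
    ring

theorem inv_Gamma_mul_Gamma {d m : ℕ} {α : ℂ} (h : α ∈ poleFree d) (hm : 0 < (α - d + m).re) :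
    (Complex.Gamma α)⁻¹ * Complex.Gamma (α - d + m) = gammaRatio d m α := by
  have h1 := Complex.inv_Gamma_eq_prod_mul (α - d) m
  have h2 := Complex.inv_Gamma_eq_prod_mul (α - d) d
  rw [sub_add_cancel] at h2
  have h3 := prod_ne_zero_of_mem_poleFree h
  have h4 := Complex.Gamma_ne_zero_of_re_pos hm
  rw [gammaRatio, eq_div_iff h3]
  rw [h2] at h1
  calc (Complex.Gamma α)⁻¹ * Complex.Gamma (α - d + m) * ∏ j ∈ Finset.range d, (α - d + j)
      = ((∏ j ∈ Finset.range d, (α - d + j)) * (Complex.Gamma α)⁻¹) *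
          Complex.Gamma (α - d + m) := by ring
    _ = _ := by rw [h1, inv_mul_cancel_right₀ h4]

theorem differentiableAt_gammaRatio {d m : ℕ} {α : ℂ} (h : α ∈ poleFree d) :
    DifferentiableAt ℂ (gammaRatio d m) α := by
  unfold gammaRatio
  refine DifferentiableAt.div ?_ ?_ (prod_ne_zero_of_mem_poleFree h) <;> fun_prop

theorem gammaRatio_eq_succ_mul {d m : ℕ} (hm : m < d) {α : ℂ} (h : α ∈ poleFree d) :
    gammaRatio d m α = gammaRatio d (m + 1) α * (α - d + m)⁻¹ := by
  have h1 : α - d + m ≠ 0 :=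
    Finset.prod_ne_zero_iff.1 (prod_ne_zero_of_mem_poleFree h) m (Finset.mem_range.2 hm)
  rw [gammaRatio, gammaRatio, Finset.prod_range_succ, div_mul_eq_mul_div,
    mul_inv_cancel_right₀ h1]

/-- For m = d - k the quotient is ∏_{i=1}^k (α - i)⁻¹ off the poles. Its logarithmic derivative at 0
is ∑ 1/i = H_k: this is the source of the harmonic numbers. -/
theorem hasDerivAt_gammaRatio_zero {d k : ℕ} (hk : k ≤ d) :
    gammaRatio d (d - k) 0 = (-1) ^ k / (k.factorial : ℂ) ∧
      HasDerivAt (gammaRatio d (d - k)) ((-1) ^ k / (k.factorial : ℂ) * ((harmonic k : ℚ) : ℂ))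
        0 := by
  have hU := (isOpen_poleFree d).mem_nhds (zero_mem_poleFree d)
  induction k with
  | zero =>
    have h1 : ∀ α ∈ poleFree d, gammaRatio d (d - 0) α = 1 := fun α hα => by
      rw [gammaRatio, Nat.sub_zero, div_self (prod_ne_zero_of_mem_poleFree hα)]
    refine ⟨by rw [h1 0 (zero_mem_poleFree d)]; simp, ?_⟩
    simp only [harmonic_zero, Rat.cast_zero, mul_zero]
    refine (hasDerivAt_const (0 : ℂ) (1 : ℂ)).congr_of_eventuallyEq ?_
    filter_upwards [hU] with α hα using h1 α hα
  | succ k ih =>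
    obtain ⟨h1, h2⟩ := ih (by omega)
    have hrec : ∀ α ∈ poleFree d, gammaRatio d (d - (k + 1)) α =
        gammaRatio d (d - k) α * (α - ((k : ℂ) + 1))⁻¹ := fun α hα => by
      rw [gammaRatio_eq_succ_mul (by omega) hα, show d - (k + 1) + 1 = d - k by omega,
        Nat.cast_sub hk]
      push_cast
      ring
    have hk0 : (k : ℂ) + 1 ≠ 0 := by exact_mod_cast Nat.succ_ne_zero k
    have hf0 : (k.factorial : ℂ) ≠ 0 := by exact_mod_cast k.factorial_ne_zero
    have hk1 : (0 : ℂ) - ((k : ℂ) + 1) ≠ 0 := by rw [zero_sub]; exact neg_ne_zero.2 hk0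
    have h3 : HasDerivAt (fun α : ℂ => (α - ((k : ℂ) + 1))⁻¹)
        (-1 / (0 - ((k : ℂ) + 1)) ^ 2) 0 :=
      ((hasDerivAt_id (0 : ℂ)).sub_const _).fun_inv hk1
    refine ⟨?_, ?_⟩
    · rw [hrec 0 (zero_mem_poleFree d), h1, Nat.factorial_succ, zero_sub]
      push_cast
      field_simp
      ring
    · refine ((h2.mul h3).congr_of_eventuallyEq ?_).congr_deriv ?_
      · filter_upwards [hU] with α hα using hrec α hα
      · rw [h1, harmonic_succ, Nat.factorial_succ, zero_sub]
        push_cast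
        field_simp
        ring

theorem hasDerivAt_inv_Gamma_zero :
    HasDerivAt (fun s : ℂ => (Complex.Gamma s)⁻¹) 1 0 := by
  have h1 : HasDerivAt (fun s : ℂ => s * (Complex.Gamma (s + 1))⁻¹)
      (1 * (Complex.Gamma (0 + 1))⁻¹ + 0 * deriv (fun s : ℂ => (Complex.Gamma (s + 1))⁻¹) 0) 0 :=
    (hasDerivAt_id (0 : ℂ)).mul (DifferentiableAt.hasDerivAt
      (DifferentiableAt.comp (g := fun s : ℂ => (Complex.Gamma s)⁻¹) (f := fun s : ℂ => s + 1) 0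
        (Complex.differentiable_one_div_Gamma (0 + 1)) (differentiableAt_id.add_const 1)))
  rw [← funext Complex.one_div_Gamma_eq_self_mul_one_div_Gamma_add_one] at h1
  simpa using h1

/-! ### Analytic continuation. -/

/-- The expression for the Barnes zeta function obtained by subtracting the first `N` terms of
the expansion of the generating function, valid for `Re α > d - N`. -/
noncomputable def barnesTrunc {d : ℕ} (u κ : ℂ) (w : Fin d → ℂ) (a : ℂ) (N : ℕ) (α : ℂ) : ℂ :=
  (∏ i, w i)⁻¹ * (∑ m ∈ Finset.range N, (-1) ^ m * bernoulliGenCoeff w m * a ^ ((d : ℤ) - m) *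
      gammaRatio d m α * Complex.exp (-α * (Complex.log (u * a) + κ)) +
    (u ^ d)⁻¹ * (Complex.exp (-α * κ) * (Complex.Gamma α)⁻¹ *
      mellin (remKernel u w N a) (α - d)))

/-- The analytic continuation of the Barnes zeta function. -/
noncomputable def barnesCont {d : ℕ} (u κ : ℂ) (w : Fin d → ℂ) (a : ℂ) (α : ℂ) : ℂ :=
  barnesTrunc u κ w a (⌊(d : ℝ) - α.re⌋₊ + 1) α

section

variable {d : ℕ} {u κ : ℂ} {w : Fin d → ℂ} {a α : ℂ} {N : ℕ}

/-- The term added to the sum is exactly what the remainder integral loses in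
`mellin_remKernel_succ`; the powers of u combine to leave (-1)^N a^{d-N}, with an integer exponent
as N may exceed d. -/
theorem barnesTrunc_succ (hw : ∀ i, 0 < (u * w i).re) (ha : 0 < (u * a).re)
    (hα : α ∈ poleFree d) (hN : d - N < α.re) :
    barnesTrunc u κ w a (N + 1) α = barnesTrunc u κ w a N α := by
  obtain ⟨hu, ha0⟩ := ne_zero_of_re_mul_pos ha
  have hs : -(N : ℝ) < (α - d).re := by simp; linarith
  have hG := inv_Gamma_mul_Gamma (m := N) hα (by simp; linarith)
  have hexp : Complex.exp (-(α - d + N) * Complex.log (u * a)) =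
      Complex.exp (-α * Complex.log (u * a)) * (u * a) ^ ((d : ℤ) - N) := by
    rw [← Complex.exp_log (mul_ne_zero hu ha0), ← Complex.exp_int_mul,
      Complex.exp_log (mul_ne_zero hu ha0), ← Complex.exp_add]
    congr 1
    push_cast
    ring
  have hpow : (-u) ^ N * (u * a) ^ ((d : ℤ) - N) = (-1) ^ N * u ^ d * a ^ ((d : ℤ) - N) := by
    rw [mul_zpow, zpow_sub₀ hu, neg_pow, zpow_natCast, zpow_natCast]
    field_simp
  have hsplit : Complex.exp (-α * (Complex.log (u * a) + κ)) =
      Complex.exp (-α * Complex.log (u * a)) * Complex.exp (-α * κ) := by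
    rw [← Complex.exp_add]; congr 1; ring
  rw [barnesTrunc, barnesTrunc, Finset.sum_range_succ, mellin_remKernel_succ hw ha hs, hexp,
    ← hG, hsplit]
  have hud : u ^ d ≠ 0 := pow_ne_zero _ hu
  congr 1
  have key : (u ^ d)⁻¹ * ((-u) ^ N * (u * a) ^ ((d : ℤ) - N)) =
      (-1) ^ N * a ^ ((d : ℤ) - N) := by
    rw [hpow]; field_simp
  linear_combination -(Complex.exp (-α * κ) * (Complex.Gamma α)⁻¹ * bernoulliGenCoeff w N *
    Complex.Gamma (α - d + N) * Complex.exp (-α * Complex.log (u * a))) * key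

theorem barnesTrunc_add (hw : ∀ i, 0 < (u * w i).re) (ha : 0 < (u * a).re)
    (hα : α ∈ poleFree d) (hN : d - N < α.re) (k : ℕ) :
    barnesTrunc u κ w a (N + k) α = barnesTrunc u κ w a N α := by
  induction k with
  | zero => rfl
  | succ k ih =>
    rw [← ih, ← add_assoc]
    refine barnesTrunc_succ hw ha hα ?_
    have : (0 : ℝ) ≤ k := Nat.cast_nonneg k
    push_cast
    linarith

theorem barnesCont_eq_barnesTrunc (hw : ∀ i, 0 < (u * w i).re) (ha : 0 < (u * a).re)
    (hα : α ∈ poleFree d) (hN : d - N < α.re) :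
    barnesCont u κ w a α = barnesTrunc u κ w a N α := by
  have h1 : (d : ℝ) - (⌊(d : ℝ) - α.re⌋₊ + 1 : ℕ) < α.re := by
    have := Nat.lt_floor_add_one ((d : ℝ) - α.re)
    push_cast
    linarith
  -- Both truncation orders are raised to their sum, where the expressions coincide.
  rw [barnesCont, ← barnesTrunc_add hw ha hα h1 N, add_comm, barnesTrunc_add hw ha hα hN]

theorem differentiableAt_barnesTrunc (hw : ∀ i, 0 < (u * w i).re) (ha : 0 < (u * a).re)
    (hα : α ∈ poleFree d) (hN : d - N < α.re) :
    DifferentiableAt ℂ (barnesTrunc u κ w a N) α := by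
  have hs : -(N : ℝ) < (α - d).re := by simp; linarith
  have h1 : DifferentiableAt ℂ (fun α => mellin (remKernel u w N a) (α - d)) α :=
    DifferentiableAt.comp (g := mellin (remKernel u w N a)) α
      (differentiableAt_mellin_remKernel hw ha hs) (differentiableAt_id.sub_const (d : ℂ))
  have h2 := Complex.differentiable_one_div_Gamma α
  have h3 : ∀ m, DifferentiableAt ℂ (gammaRatio d m) α := fun m => differentiableAt_gammaRatio hα
  unfold barnesTrunc
  fun_prop

/-- The truncation order in `barnesCont` jumps with Re α, but near any point one fixed N serves. -/
theorem differentiableOn_barnesCont (hw : ∀ i, 0 < (u * w i).re) (ha : 0 < (u * a).re) :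
    DifferentiableOn ℂ (barnesCont u κ w a) (poleFree d) := by
  intro α hα
  obtain ⟨N, hN⟩ := exists_nat_gt ((d : ℝ) - α.re)
  have hN' : (d : ℝ) - N < α.re := by linarith
  refine ((differentiableAt_barnesTrunc (κ := κ) hw ha hα hN').congr_of_eventuallyEq
    ?_).differentiableWithinAt
  filter_upwards [(isOpen_poleFree d).mem_nhds hα,
    (isOpen_lt continuous_const Complex.continuous_re).mem_nhds hN'] with β hβ hβN
  exact barnesCont_eq_barnesTrunc hw ha hβ hβN

theorem barnesCont_eq_mellin (hw : ∀ i, 0 < (u * w i).re) (ha : 0 < (u * a).re)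
    (hα : d < α.re) : barnesCont u κ w a α =
      Complex.exp (-α * κ) * (Complex.Gamma α)⁻¹ * mellin (barnesKernel u w a) α := by
  have hud : u ^ d ≠ 0 := pow_ne_zero _ (ne_zero_of_re_mul_pos ha).1
  have hW : ∏ i, w i ≠ 0 :=
    Finset.prod_ne_zero_iff.2 fun i _ => (ne_zero_of_re_mul_pos (hw i)).2
  rw [barnesCont_eq_barnesTrunc (N := 0) hw ha (mem_poleFree_of_lt_re hα) (by simpa using hα),
    barnesTrunc, mellin_remKernel_zero, Finset.range_zero, Finset.sum_empty, zero_add]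
  field_simp

theorem inv_Gamma_mul_term (hα : 0 < α.re) (z : ℂ) :
    Complex.exp (-α * κ) * (Complex.Gamma α)⁻¹ * (Complex.Gamma α *
      Complex.exp (-α * Complex.log z)) = Complex.exp (-α * (Complex.log z + κ)) := by
  rw [mul_add, Complex.exp_add]
  field_simp [Complex.Gamma_ne_zero_of_re_pos hα]

theorem hasSum_barnesCont (hd : 1 ≤ d) (hw : ∀ i, 0 < (u * w i).re) (ha : 0 < (u * a).re)
    (hα : d < α.re) :
    HasSum (fun n : Fin d → ℕ => Complex.exp (-α * (Complex.log (u * latticePoint a w n) + κ)))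
      (barnesCont u κ w a α) := by
  have h := (hasSum_mellin_barnesKernel hd hw ha hα).mul_left
    (Complex.exp (-α * κ) * (Complex.Gamma α)⁻¹)
  simp_rw [inv_Gamma_mul_term (lt_of_le_of_lt (Nat.cast_nonneg d) hα)] at h
  rwa [barnesCont_eq_mellin hw ha hα]

/-- For Re α > d this is the kernel identity under the Mellin transform. Both sides are analytic off
the poles, so it extends, in particular to α = 0 where the series no longer converges. -/
theorem sum_barnesCont (hw : ∀ i, 0 < (u * w i).re) (ha : 0 < (u * a).re)
    (hα : α ∈ poleFree d) (M : ℕ) :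
    ∑ S : Finset (Fin d), (-1) ^ S.card * barnesCont u κ w (a + ∑ i ∈ S, M * w i) α =
      ∑ n ∈ Fintype.piFinset (fun _ : Fin d => Finset.range M),
        Complex.exp (-α * (Complex.log (u * latticePoint a w n) + κ)) := by
  refine eqOn_poleFree (d := d)
    (f := fun α => ∑ S : Finset (Fin d), (-1) ^ S.card *
      barnesCont u κ w (a + ∑ i ∈ S, M * w i) α)
    (g := fun α => ∑ n ∈ Fintype.piFinset (fun _ : Fin d => Finset.range M),
        Complex.exp (-α * (Complex.log (u * latticePoint a w n) + κ))) ?_ ?_ ?_ hα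
  · exact DifferentiableOn.fun_sum fun S _ => (differentiableOn_const _).mul
      (differentiableOn_barnesCont hw (re_mul_add_sum_pos hw ha M S))
  · fun_prop
  · intro β hβ
    have h := congrArg (fun x => Complex.exp (-β * κ) * (Complex.Gamma β)⁻¹ * x)
      (sum_mellin_barnesKernel hw ha hβ M)
    simp only [Finset.mul_sum] at h
    simp_rw [inv_Gamma_mul_term (lt_of_le_of_lt (Nat.cast_nonneg d) hβ)] at h
    rw [← h]
    refine Finset.sum_congr rfl fun S _ => ?_
    rw [barnesCont_eq_mellin hw (re_mul_add_sum_pos hw ha M S) hβ]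
    ring

/-! ### The derivative at 0. -/

/-- The main part of the derivative of the Barnes zeta function at `0`. -/
noncomputable def barnesDerivMain {d : ℕ} (u κ : ℂ) (w : Fin d → ℂ) (a : ℂ) : ℂ :=
  (-1) ^ d * ∑ m ∈ Finset.range (d + 1), bernoulliGenCoeff w m / (∏ i, w i) /
    ((d - m).factorial : ℂ) * a ^ (d - m) *
      (((harmonic (d - m) : ℚ) : ℂ) - (Complex.log (u * a) + κ))

/-- Since 1/Γ vanishes at 0 with derivative 1, only the value of the remainder integral at -d
enters, not its derivative. -/
theorem hasDerivAt_barnesCont_zero (hw : ∀ i, 0 < (u * w i).re) (ha : 0 < (u * a).re) :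
    HasDerivAt (barnesCont u κ w a) (barnesDerivMain u κ w a +
      (∏ i, w i)⁻¹ * (u ^ d)⁻¹ * mellin (remKernel u w (d + 1) a) (-d)) 0 := by
  -- The order d + 1 is the smallest N for which d - N < Re α allows α = 0.
  have hN : (d : ℝ) - (d + 1 : ℕ) < (0 : ℂ).re := by simp
  have hs : -((d + 1 : ℕ) : ℝ) < ((0 : ℂ) - d).re := by simp
  have heq : barnesCont u κ w a =ᶠ[𝓝 0] barnesTrunc u κ w a (d + 1) := by
    filter_upwards [(isOpen_poleFree d).mem_nhds (zero_mem_poleFree d),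
      (isOpen_lt continuous_const Complex.continuous_re).mem_nhds hN] with β hβ hβN
    exact barnesCont_eq_barnesTrunc hw ha hβ hβN
  refine HasDerivAt.congr_of_eventuallyEq ?_ heq
  have h1 : DifferentiableAt ℂ (fun α => mellin (remKernel u w (d + 1) a) (α - d)) 0 :=
    DifferentiableAt.comp (g := mellin (remKernel u w (d + 1) a)) 0
      (differentiableAt_mellin_remKernel hw ha hs) (differentiableAt_id.sub_const (d : ℂ))
  have hexp : ∀ c : ℂ, HasDerivAt (fun α : ℂ => Complex.exp (-α * c)) (-c) 0 := fun c => by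
    simpa using! ((hasDerivAt_id (0 : ℂ)).fun_neg.mul_const c).cexp
  have h2 := (((hexp κ).mul hasDerivAt_inv_Gamma_zero).mul h1.hasDerivAt).const_mul (u ^ d)⁻¹
  have h3 : ∀ m ∈ Finset.range (d + 1), HasDerivAt (fun α => (-1) ^ m * bernoulliGenCoeff w m *
      a ^ ((d : ℤ) - m) * gammaRatio d m α * Complex.exp (-α * (Complex.log (u * a) + κ)))
      ((-1) ^ d * (bernoulliGenCoeff w m / ((d - m).factorial : ℂ) * a ^ (d - m) *
        (((harmonic (d - m) : ℚ) : ℂ) - (Complex.log (u * a) + κ)))) 0 := by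
    intro m hm
    have hm' : m ≤ d := Nat.lt_succ_iff.1 (Finset.mem_range.1 hm)
    obtain ⟨g0, g1⟩ := hasDerivAt_gammaRatio_zero (d := d) (k := d - m) (Nat.sub_le _ _)
    rw [Nat.sub_sub_self hm'] at g0 g1
    refine ((g1.const_mul _).mul (hexp _)).congr_deriv ?_
    have hz : a ^ ((d : ℤ) - m) = a ^ (d - m) := by
      rw [← Nat.cast_sub hm', zpow_natCast]
    have hsign : (-1 : ℂ) ^ d = (-1) ^ m * (-1) ^ (d - m) := by
      rw [← pow_add, Nat.add_sub_cancel' hm']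
    rw [g0, hz, hsign]
    simp only [neg_zero, zero_mul, Complex.exp_zero]
    ring
  refine (((HasDerivAt.fun_sum h3).add h2).const_mul (∏ i, w i)⁻¹).congr_deriv ?_
  rw [barnesDerivMain, mul_add, ← Finset.mul_sum]
  congr 1
  · rw [mul_left_comm, Finset.mul_sum]
    congr 1
    exact Finset.sum_congr rfl fun m _ => by ring
  · simp [mul_assoc]

end

/-! ### Finite differences over the vertices of a box. -/

theorem rescale_exp_add_sum {ι : Type*} (a : ℂ) (v : ι → ℂ) (S : Finset ι) :
    PowerSeries.rescale (a + ∑ i ∈ S, v i) (PowerSeries.exp ℂ) =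
      PowerSeries.rescale a (PowerSeries.exp ℂ) *
        ∏ i ∈ S, PowerSeries.rescale (v i) (PowerSeries.exp ℂ) := by
  classical
  induction S using Finset.induction_on with
  | empty => simp
  | insert i S hi ih =>
    rw [Finset.sum_insert hi, Finset.prod_insert hi, add_left_comm,
      ← PowerSeries.exp_mul_exp_eq_exp_add, ih]
    ring

/-- The top-degree alternating sum of powers over the vertices of a parallelepiped. -/
theorem sum_neg_one_pow_mul_pow {d k : ℕ} (hk : k ≤ d) (a : ℂ) (v : Fin d → ℂ) :
    ∑ S : Finset (Fin d), (-1) ^ (d - S.card) * (a + ∑ i ∈ S, v i) ^ k =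
      if k = d then (d.factorial : ℂ) * ∏ i, v i else 0 := by
  -- Generating function of all the power sums: it equals e^{az} ∏ (e^{v_i z} - 1), which starts at
  -- z^d with coefficient ∏ v_i.
  have h1 : ∑ S : Finset (Fin d), (-1) ^ (d - S.card) *
      PowerSeries.rescale (a + ∑ i ∈ S, v i) (PowerSeries.exp ℂ) =
      PowerSeries.X ^ d * (PowerSeries.C (∏ i, v i) *
        (PowerSeries.rescale a (PowerSeries.exp ℂ) * ∏ i, expQuotient (v i))) := by
    have h2 : ∏ i, (PowerSeries.rescale (v i) (PowerSeries.exp ℂ) + -1) =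
        PowerSeries.X ^ d * (PowerSeries.C (∏ i, v i) * ∏ i, expQuotient (v i)) := by
      simp only [← sub_eq_add_neg, ← X_mul_expQuotient, Finset.prod_mul_distrib, map_prod,
        Finset.prod_const, Finset.card_univ, Fintype.card_fin]
      ring
    rw [Finset.prod_add, Finset.powerset_univ] at h2
    calc _ = PowerSeries.rescale a (PowerSeries.exp ℂ) * ∑ S : Finset (Fin d),
          (∏ i ∈ S, PowerSeries.rescale (v i) (PowerSeries.exp ℂ)) *
            ∏ _i ∈ Finset.univ \ S, (-1) := by
          rw [Finset.mul_sum]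
          refine Finset.sum_congr rfl fun S _ => ?_
          rw [rescale_exp_add_sum, Finset.prod_const, Finset.card_univ_sdiff, Fintype.card_fin]
          ring
      _ = _ := by rw [h2]; ring
  have hf : (k.factorial : ℂ) ≠ 0 := by exact_mod_cast k.factorial_ne_zero
  have h3 := congrArg (PowerSeries.coeff k) h1
  have h4 : ∀ S : Finset (Fin d), PowerSeries.coeff k ((-1) ^ (d - S.card) *
      PowerSeries.rescale (a + ∑ i ∈ S, v i) (PowerSeries.exp ℂ)) =
      (-1) ^ (d - S.card) * (a + ∑ i ∈ S, v i) ^ k * (k.factorial : ℂ)⁻¹ := by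
    intro S
    rw [show (-1 : PowerSeries ℂ) ^ (d - S.card) = PowerSeries.C ((-1) ^ (d - S.card)) by simp,
      PowerSeries.coeff_C_mul, PowerSeries.coeff_rescale, PowerSeries.coeff_exp]
    simp [mul_assoc]
  rw [map_sum, Finset.sum_congr rfl fun S _ => h4 S, ← Finset.sum_mul,
    PowerSeries.coeff_X_pow_mul', ← div_eq_mul_inv, div_eq_iff hf] at h3
  rw [h3]
  by_cases hkd : k = d
  · subst hkd
    have h0 : PowerSeries.constantCoeff (PowerSeries.rescale a (PowerSeries.exp ℂ)) = 1 := by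
      rw [← PowerSeries.coeff_zero_eq_constantCoeff_apply, PowerSeries.coeff_rescale]
      simp
    have h5 : ∀ i, PowerSeries.constantCoeff (expQuotient (v i)) = 1 := fun i => by
      simp [expQuotient]
    simp [h0, h5, mul_comm]
  · rw [if_neg (by omega), if_neg hkd, zero_mul]

theorem barnesF_eq {d : ℕ} (v : Fin d → ℂ) (g : ℂ → ℂ) :
    barnesF v g = ∑ S : Finset (Fin d), (-1) ^ (d - S.card) * g (∑ i ∈ S, v i) -
      (-1) ^ d * g 0 := by
  have h : (Finset.univ.filter fun S : Finset (Fin d) => S.Nonempty) = Finset.univ.erase ∅ := by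
    ext S
    simp [Finset.nonempty_iff_ne_empty]
  rw [barnesF, h, ← Finset.add_sum_erase _ _ (Finset.mem_univ ∅)]
  simp

/-! ### Passage to the limit. -/

section

variable {d : ℕ} {u κ : ℂ} {w : Fin d → ℂ} {a s : ℂ} {N : ℕ}

/-- The shift multiplies the kernel by the M-th power of a number of modulus less than 1 for t > 0,
so dominated convergence applies with the unshifted kernel as majorant. Nonemptiness of S makes the
modulus strictly smaller than 1. -/
theorem tendsto_mellin_remKernel (hw : ∀ i, 0 < (u * w i).re) (ha : 0 < (u * a).re)
    (hs : -(N : ℝ) < s.re) {S : Finset (Fin d)} (hS : S.Nonempty) :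
    Tendsto (fun M : ℕ => mellin (remKernel u w N (a + ∑ i ∈ S, M * w i)) s) atTop (𝓝 0) := by
  have hconv := mellinConvergent_remKernel hw ha hs
  have hr : 0 < (u * ∑ i ∈ S, w i).re := by
    rw [Finset.mul_sum, Complex.re_sum]
    exact Finset.sum_pos (fun i _ => hw i) hS
  have hker : ∀ (M : ℕ) (t : ℝ), remKernel u w N (a + ∑ i ∈ S, M * w i) t =
      remKernel u w N a t * Complex.exp (-((u * ∑ i ∈ S, w i) * t)) ^ M := by
    intro M t
    rw [remKernel, remKernel, mul_assoc (bernoulliGenRem _ _ _), ← Complex.exp_nat_mul,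
      ← Complex.exp_add, ← Finset.mul_sum]
    congr 2
    ring
  have hnorm : ∀ t : ℝ, 0 < t → ‖Complex.exp (-((u * ∑ i ∈ S, w i) * t))‖ < 1 := fun t ht => by
    rw [norm_cexp_neg_mul_ofReal, Real.exp_lt_one_iff]
    nlinarith
  rw [← integral_zero ℝ ℂ (μ := volume.restrict (Ioi 0))]
  refine tendsto_integral_of_dominated_convergence
    (fun t : ℝ => ‖(t : ℂ) ^ (s - 1) • remKernel u w N a t‖) (fun M => ?_) hconv.norm
    (fun M => ?_) ?_
  · exact (mellinConvergent_remKernel hw (re_mul_add_sum_pos hw ha M S) hs).aestronglyMeasurable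
  · filter_upwards [ae_restrict_mem measurableSet_Ioi] with t ht
    rw [hker, ← smul_mul_assoc, norm_mul, norm_pow]
    exact mul_le_of_le_one_right (norm_nonneg _) (pow_le_one₀ (norm_nonneg _) (hnorm t ht).le)
  · filter_upwards [ae_restrict_mem measurableSet_Ioi] with t ht
    simp_rw [hker, ← smul_mul_assoc]
    simpa using (tendsto_pow_atTop_nhds_zero_of_norm_lt_one (hnorm t ht)).const_mul
      ((t : ℂ) ^ (s - 1) • remKernel u w N a t)

/-- The contribution of the remainder to the derivative of the Barnes zeta function at `0`. -/
noncomputable def barnesDerivRem {d : ℕ} (u : ℂ) (w : Fin d → ℂ) (a : ℂ) : ℂ :=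
  (∏ i, w i)⁻¹ * (u ^ d)⁻¹ * mellin (remKernel u w (d + 1) a) (-d)

theorem sum_deriv_barnesCont (hw : ∀ i, 0 < (u * w i).re) (ha : 0 < (u * a).re) (M : ℕ) :
    ∑ S : Finset (Fin d), (-1) ^ S.card * (barnesDerivMain u κ w (a + ∑ i ∈ S, M * w i) +
        barnesDerivRem u w (a + ∑ i ∈ S, M * w i)) =
      -∑ n ∈ Fintype.piFinset (fun _ : Fin d => Finset.range M),
        (Complex.log (u * latticePoint a w n) + κ) := by
  have h1 := HasDerivAt.fun_sum (u := Finset.univ) fun (S : Finset (Fin d)) _ =>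
    (hasDerivAt_barnesCont_zero (κ := κ) hw (re_mul_add_sum_pos hw ha M S)).const_mul
      ((-1) ^ S.card)
  have h2 := HasDerivAt.fun_sum (u := Fintype.piFinset (fun _ : Fin d => Finset.range M))
    fun n _ => ((hasDerivAt_id (0 : ℂ)).fun_neg.mul_const
      (Complex.log (u * latticePoint a w n) + κ)).cexp
  have heq : (fun α => ∑ n ∈ Fintype.piFinset (fun _ : Fin d => Finset.range M),
      Complex.exp (-(id α) * (Complex.log (u * latticePoint a w n) + κ))) =ᶠ[𝓝 0]
      fun α => ∑ S : Finset (Fin d), (-1) ^ S.card *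
        barnesCont u κ w (a + ∑ i ∈ S, M * w i) α := by
    filter_upwards [(isOpen_poleFree d).mem_nhds (zero_mem_poleFree d)] with α hα
    exact (sum_barnesCont hw ha hα M).symm
  have h3 := h1.unique (h2.congr_of_eventuallyEq heq.symm)
  simp only [barnesDerivRem]
  rw [h3, ← Finset.sum_neg_distrib]
  simp

theorem bernoulliGenCoeff_zero (w : Fin d → ℂ) : bernoulliGenCoeff w 0 = 1 := by
  rw [bernoulliGenCoeff, PowerSeries.coeff_zero_eq_constantCoeff_apply, map_prod]
  refine Finset.prod_eq_one fun i _ => ?_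
  simp [expQuotient]

theorem sum_barnesDerivMain (hw : ∀ i, w i ≠ 0) (M : ℕ) :
    ∑ S : Finset (Fin d), (-1) ^ S.card * barnesDerivMain u κ w (a + ∑ i ∈ S, M * w i) =
      ((harmonic d : ℚ) : ℂ) * (M : ℂ) ^ d -
      ∑ m ∈ Finset.range (d + 1), bernoulliGenCoeff w m / (∏ i, w i) / ((d - m).factorial : ℂ) *
        (barnesF (fun i => (M : ℂ) * w i)
          (fun x => (a + x) ^ (d - m) * (Complex.log (u * (a + x)) + κ)) +
          (-1) ^ d * (a ^ (d - m) * (Complex.log (u * a) + κ))) := by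
  have hW : ∏ i, w i ≠ 0 := Finset.prod_ne_zero_iff.2 fun i _ => hw i
  have hf : (d.factorial : ℂ) ≠ 0 := by exact_mod_cast d.factorial_ne_zero
  set q : ℕ → ℂ := fun m => bernoulliGenCoeff w m / (∏ i, w i) / ((d - m).factorial : ℂ) with hq
  have hsign : ∀ S : Finset (Fin d), ((-1) ^ S.card * (-1) ^ d : ℂ) = (-1) ^ (d - S.card) := by
    intro S
    have hS : S.card ≤ d := by simpa using S.card_le_univ
    have hd : (-1 : ℂ) ^ d = (-1) ^ S.card * (-1) ^ (d - S.card) := by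
      rw [← pow_add, Nat.add_sub_cancel' hS]
    rw [hd, ← mul_assoc, ← mul_pow]
    simp
  -- Degrees d - m < d are annihilated. For m = 0 the difference is d! M^d ∏ w_i, which cancels the
  -- denominator of `q 0`.
  have hH : ∑ m ∈ Finset.range (d + 1), q m * ((harmonic (d - m) : ℚ) : ℂ) *
      ∑ S : Finset (Fin d), (-1) ^ (d - S.card) * (a + ∑ i ∈ S, M * w i) ^ (d - m) =
      ((harmonic d : ℚ) : ℂ) * (M : ℂ) ^ d := by
    rw [Finset.sum_range_succ']
    have h0 : ∀ m ∈ Finset.range d, q (m + 1) * ((harmonic (d - (m + 1)) : ℚ) : ℂ) *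
        ∑ S : Finset (Fin d), (-1) ^ (d - S.card) * (a + ∑ i ∈ S, M * w i) ^ (d - (m + 1)) = 0 := by
      intro m hm
      have hm' := Finset.mem_range.1 hm
      rw [sum_neg_one_pow_mul_pow (Nat.sub_le _ _), if_neg (by omega), mul_zero]
    rw [Finset.sum_eq_zero h0, zero_add, Nat.sub_zero, sum_neg_one_pow_mul_pow le_rfl, if_pos rfl,
      Finset.prod_mul_distrib, Finset.prod_const, Finset.card_univ, Fintype.card_fin]
    simp only [hq, bernoulliGenCoeff_zero, Nat.sub_zero]
    field_simp
  have hF : ∀ m, barnesF (fun i => (M : ℂ) * w i)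
      (fun x => (a + x) ^ (d - m) * (Complex.log (u * (a + x)) + κ)) +
        (-1) ^ d * (a ^ (d - m) * (Complex.log (u * a) + κ)) =
      ∑ S : Finset (Fin d), (-1) ^ (d - S.card) * ((a + ∑ i ∈ S, M * w i) ^ (d - m) *
        (Complex.log (u * (a + ∑ i ∈ S, M * w i)) + κ)) := by
    intro m
    rw [barnesF_eq, add_zero, sub_add_cancel]
  simp_rw [hF]
  rw [← hH, ← Finset.sum_sub_distrib]
  simp_rw [barnesDerivMain, ← mul_assoc, hsign, Finset.mul_sum]
  rw [Finset.sum_comm]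
  refine Finset.sum_congr rfl fun m _ => ?_
  rw [← Finset.sum_sub_distrib]
  refine Finset.sum_congr rfl fun S _ => ?_
  simp only [hq]
  ring

/-- For every M the expression equals the claimed limit plus the remainders at the nonempty S,
exactly. F omits S = ∅, and the logarithmic terms restored there cancel those of the main part at a.
-/
theorem tendsto_barnes (hw : ∀ i, 0 < (u * w i).re) (ha : 0 < (u * a).re) :
    Tendsto (fun M : ℕ => -((harmonic d : ℚ) : ℂ) * (M : ℂ) ^ d +
      ∑ m ∈ Finset.range (d + 1), bernoulliGenCoeff w m / (∏ i, w i) / ((d - m).factorial : ℂ) *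
        barnesF (fun i => (M : ℂ) * w i)
          (fun x => (a + x) ^ (d - m) * (Complex.log (u * (a + x)) + κ)) -
      ∑ n ∈ Fintype.piFinset (fun _ : Fin d => Finset.range M),
        (Complex.log (u * latticePoint a w n) + κ)) atTop
      (𝓝 (barnesDerivMain u κ w a + barnesDerivRem u w a -
        (-1) ^ d * ∑ m ∈ Finset.range (d + 1), bernoulliGenCoeff w m / (∏ i, w i) /
          ((d - m).factorial : ℂ) * ((harmonic (d - m) : ℚ) : ℂ) * a ^ (d - m))) := by
  have hlim : Tendsto (fun M : ℕ => ∑ S ∈ Finset.univ.erase (∅ : Finset (Fin d)),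
      (-1) ^ S.card * barnesDerivRem u w (a + ∑ i ∈ S, M * w i)) atTop (𝓝 0) := by
    rw [← Finset.sum_const_zero (s := Finset.univ.erase (∅ : Finset (Fin d)))]
    refine tendsto_finsetSum _ fun S hS => ?_
    have hS' := Finset.nonempty_iff_ne_empty.2 (Finset.ne_of_mem_erase hS)
    have h := tendsto_mellin_remKernel (N := d + 1) (s := -d) hw ha (by simp) hS'
    simpa [barnesDerivRem] using
      (h.const_mul ((∏ i, w i)⁻¹ * (u ^ d)⁻¹)).const_mul ((-1) ^ S.card)
  have h := hlim.const_add (barnesDerivMain u κ w a + barnesDerivRem u w a -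
        (-1) ^ d * ∑ m ∈ Finset.range (d + 1), bernoulliGenCoeff w m / (∏ i, w i) /
          ((d - m).factorial : ℂ) * ((harmonic (d - m) : ℚ) : ℂ) * a ^ (d - m))
  rw [add_zero] at h
  refine h.congr fun M => ?_
  have h1 := sum_deriv_barnesCont (κ := κ) hw ha M
  simp_rw [mul_add] at h1
  rw [Finset.sum_add_distrib, sum_barnesDerivMain fun i => (ne_zero_of_re_mul_pos (hw i)).2,
    ← Finset.add_sum_erase Finset.univ (fun S : Finset (Fin d) =>
      (-1) ^ S.card * barnesDerivRem u w (a + ∑ i ∈ S, M * w i)) (Finset.mem_univ ∅)] at h1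
  simp only [Finset.card_empty, pow_zero, one_mul, Finset.sum_empty, add_zero, mul_add,
    Finset.sum_add_distrib] at h1
  rw [barnesDerivMain]
  simp only [mul_sub, Finset.sum_sub_distrib]
  have h2 : ∑ m ∈ Finset.range (d + 1), bernoulliGenCoeff w m / (∏ i, w i) /
      ((d - m).factorial : ℂ) * ((-1) ^ d * (a ^ (d - m) * Complex.log (u * a))) +
      ∑ m ∈ Finset.range (d + 1), bernoulliGenCoeff w m / (∏ i, w i) /
      ((d - m).factorial : ℂ) * ((-1) ^ d * (a ^ (d - m) * κ)) =
      (-1) ^ d * ∑ m ∈ Finset.range (d + 1), bernoulliGenCoeff w m / (∏ i, w i) /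
      ((d - m).factorial : ℂ) * a ^ (d - m) * (Complex.log (u * a) + κ) := by
    rw [← Finset.sum_add_distrib, Finset.mul_sum]
    exact Finset.sum_congr rfl fun m _ => by ring
  have h3 : ∑ m ∈ Finset.range (d + 1), bernoulliGenCoeff w m / (∏ i, w i) /
      ((d - m).factorial : ℂ) * a ^ (d - m) * ((harmonic (d - m) : ℚ) : ℂ) =
      ∑ m ∈ Finset.range (d + 1), bernoulliGenCoeff w m / (∏ i, w i) /
      ((d - m).factorial : ℂ) * ((harmonic (d - m) : ℚ) : ℂ) * a ^ (d - m) :=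
    Finset.sum_congr rfl fun m _ => by ring
  simp only [mul_add, Finset.sum_add_distrib] at h2 ⊢
  rw [h3]
  linear_combination h1 + h2

end

/-! ### Assembly of the theorem. -/

theorem mainTheorem3 (d : ℕ) (hd : 1 ≤ d) (θ : ℝ) (L : ℂ → ℂ)
    (hL : IsLogBranch L (halfPlane θ)) (a : ℂ) (w : Fin d → ℂ)
    (ha : a ∈ halfPlane θ) (hw : ∀ i, w i ∈ halfPlane θ) :
    IsBarnesZeta L a w (barnesZeta L a w) ∧
    ∃ ℓ : ℂ,
      Filter.Tendsto
        (fun M : ℕ =>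
          -((harmonic d : ℚ) : ℂ) * (M : ℂ) ^ d
          + ∑ m ∈ Finset.range (d + 1),
              bernoullianCoeff w m / ((m.factorial : ℂ) * ((d - m).factorial : ℂ)) *
                barnesF (fun i => (M : ℂ) * w i) (fun x => (a + x) ^ (d - m) * L (a + x))
          - ∑ n ∈ Fintype.piFinset (fun _ : Fin d => Finset.range M), L (latticePoint a w n))
        Filter.atTop (nhds ℓ) ∧
      deriv (barnesZeta L a w) 0 =
        ℓ + (-1) ^ d * ∑ m ∈ Finset.range (d + 1),
              bernoullianCoeff w m * ((harmonic (d - m) : ℚ) : ℂ) /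
                ((m.factorial : ℂ) * ((d - m).factorial : ℂ)) * a ^ (d - m) := by
  set u : ℂ := Complex.exp (-((θ : ℂ) * Complex.I)) with hu
  have hmem : ∀ z, z ∈ halfPlane θ ↔ 0 < (u * z).re := fun z => by
    rw [mul_comm]; exact Iff.rfl
  have ha' := (hmem a).1 ha
  have hw' : ∀ i, 0 < (u * w i).re := fun i => (hmem _).1 (hw i)
  have hconn : IsPreconnected (halfPlane θ) := by
    have hlin : IsLinearMap ℝ fun z : ℂ => (z * u).re :=
      ⟨fun x y => by rw [add_mul, Complex.add_re], fun c x => by simp [mul_assoc, mul_sub]⟩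
    exact (convex_halfSpace_gt hlin 0).isPreconnected
  obtain ⟨κ, -, hκ⟩ := hL.exists_eq_log_add hconn (fun z hz => (hmem z).1 hz) ⟨a, ha⟩
  have hLp : ∀ n : Fin d → ℕ, L (latticePoint a w n) =
      Complex.log (u * latticePoint a w n) + κ :=
    fun n => hκ _ ((hmem _).2 (re_mul_latticePoint_pos hw' ha' n))
  have hcont : IsBarnesZeta L a w (barnesCont u κ w a) := by
    refine ⟨fun α hα => ?_, differentiableOn_barnesCont hw' ha'⟩
    simp_rw [hLp]
    exact hasSum_barnesCont hd hw' ha' hα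
  -- The chosen function has the defining properties because `barnesCont` shows that some function
  -- does; uniqueness of continuation then identifies the two off the poles.
  have hZ : IsBarnesZeta L a w (barnesZeta L a w) := Classical.epsilon_spec ⟨_, hcont⟩
  have heq : EqOn (barnesZeta L a w) (barnesCont u κ w a) (poleFree d) :=
    eqOn_poleFree hZ.2 hcont.2 fun α hα => (hZ.1 α hα).unique (hcont.1 α hα)
  have hderiv : deriv (barnesZeta L a w) 0 = barnesDerivMain u κ w a + barnesDerivRem u w a :=
    ((hasDerivAt_barnesCont_zero hw' ha').congr_of_eventuallyEq
      (heq.eventuallyEq_of_mem ((isOpen_poleFree d).mem_nhds (zero_mem_poleFree d)))).deriv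
  have hcoeff : ∀ m, bernoullianCoeff w m / ((m.factorial : ℂ) * ((d - m).factorial : ℂ)) =
      bernoulliGenCoeff w m / (∏ i, w i) / ((d - m).factorial : ℂ) := fun m => by
    have hm : (m.factorial : ℂ) ≠ 0 := by exact_mod_cast m.factorial_ne_zero
    rw [bernoullianCoeff_eq hd]
    field_simp
  have hFL : ∀ m M : ℕ, barnesF (fun i => (M : ℂ) * w i) (fun x => (a + x) ^ (d - m) * L (a + x)) =
      barnesF (fun i => (M : ℂ) * w i)
        (fun x => (a + x) ^ (d - m) * (Complex.log (u * (a + x)) + κ)) := fun m M =>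
    Finset.sum_congr rfl fun S _ => by
      beta_reduce
      rw [hκ _ ((hmem _).2 (re_mul_add_sum_pos hw' ha' M S))]
  have hlim := tendsto_barnes (κ := κ) hw' ha'
  refine ⟨hZ, _, by simp_rw [hcoeff, hFL, hLp]; exact hlim, ?_⟩
  simp_rw [hderiv, mul_div_right_comm, hcoeff]
  exact (sub_add_cancel _ _).symm
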